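/- Let $VB_n$ be the virtual braid group on $n$ strands: generators $\sigma_1,\dots,\sigma_{n-1},\rho_1,\dots,\rho_{n-1}$; relations $\sigma_i\sigma_{i+1}\sigma_i=\sigma_{i+1}\sigma_i\sigma_{i+1}$, $\sigma_i\sigma_j=\sigma_j\sigma_i$ ($|i-j|>1$), $\rho_i^2=1$, $\rho_i\rho_{i+1}\rho_i=\rho_{i+1}\rho_i\rho_{i+1}$, $\rho_i\rho_j=\rho_j\rho_i$ ($|i-j|>1$), $\sigma_i\rho_j=\rho_j\sigma_i$ ($|i-j|>1$), $\rho_i\rho_{i+1}\sigma_i=\sigma_{i+1}\rho_i\rho_{i+1}$. Let $VP_n$, the virtual pure braid group, be the kernel of the homomorphism $VB_n\to S_n$ sending both $\sigma_i$ and $\rho_i$ to the transposition $(i\;i+1)$. In $VP_n$ put $\lambda_{i,i+1}=\rho_i\sigma_i^{-1}$, $\lambda_{i+1,i}=\sigma_i^{-1}\rho_i$ and, for $i<j-1$, $\lambda_{i,j}=\rho_{j-1}\cdots\rho_{i+1}\,\lambda_{i,i+1}\,\rho_{i+1}\cdots\rho_{j-1}$ and $\lambda_{j,i}=\rho_{j-1}\cdots\rho_{i+1}\,\lambda_{i+1,i}\,\rho_{i+1}\cdots\rho_{j-1}$.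 Let $\mathcal R^V(n)$ be the set of relations $$\lambda_{ij}\lambda_{kl}=\lambda_{kl}\lambda_{ij},\qquad \lambda_{ki}\lambda_{kj}\lambda_{ij}=\lambda_{ij}\lambda_{kj}\lambda_{ki}$$ between words in the letters $\lambda_{ij}$, $1\le i\ne j\le n$, where distinct letters stand for distinct indices in $\{1,\dots,n\}$. For $0\le t\le n-1$ the degeneracy $s_t$ (doubling of the $(t+1)$-st strand) replaces the letters $\lambda_{k,l}$, $\lambda_{l,k}$ ($1\le k<l\le n$) by the following words in the letters $\lambda_{ij}$, $1\le i\neq j\le n+1$, where $y^x=x^{-1}yx$: $$s_t(\lambda_{k,l})=\begin{cases}\lambda_{k+1,l+1}& t<k-1,\\ \lambda_{k,l+1}\lambda_{k+1,l+1}& t=k-1,\\ \lambda_{k,l+1}& k-1<t<l-1,\\ \lambda_{k,l+1}^{\lambda_{1,l}\lambda_{2,l}\cdots\lambda_{k-1,l}}\,\lambda_{k,l}& t=l-1,\\ \lambda_{k,l}& t>l-1,\end{cases}$$ $$s_t(\lambda_{l,k})=\begin{cases}\lambda_{l+1,k+1}& t<k-1,\\ \lambda_{l+1,k+1}\lambda_{l+1,k}&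 t=k-1,\\ \lambda_{l+1,k}& k-1<t<l-1,\\ \lambda_{l,k}\,\lambda_{l+1,k}^{\lambda_{l,1}^{-1}\lambda_{l,2}^{-1}\cdots\lambda_{l,k-1}^{-1}}& t=l-1,\\ \lambda_{l,k}& t>l-1.\end{cases}$$ **Theorem.** Let $n\ge 4$. Adding a trivial last strand ($\sigma_i\mapsto\sigma_i$, $\rho_i\mapsto\rho_i$) induces an injective homomorphism $VP_n\to VP_{n+1}$ with $\lambda_{ij}\mapsto\lambda_{ij}$, by which $VP_n$ is viewed as a subgroup of $VP_{n+1}$; for each $0\le t\le n-1$ the rule above defines a unique homomorphism $s_t\colon VP_n\to VP_{n+1}$; and $$\mathcal R^V(n)\cup\bigcup_{t=0}^{n-1}s_t(\mathcal R^V(n))$$ is a complete set of defining relations for $VP_{n+1}$ on the generators $\lambda_{ij}$, $1\le i\ne j\le n+1$; that is, the group with these generators and relations is isomorphic to $VP_{n+1}$ by the isomorphism sending each letter $\lambda_{ij}$ to the element $\lambda_{ij}$. -/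

import Mathlib

namespace VirtualBraid

/-- Generators of the virtual braid group on `n` strands. Strands are numbered `0, …, n - 1`;
`sigma i` and `rho i` involve the strands `i` and `i + 1`. -/
inductive VBGen (n : ℕ) : Type
  | sigma (i : ℕ) (h : i + 1 < n) : VBGen n
  | rho (i : ℕ) (h : i + 1 < n) : VBGen n

/-- The free generator `σ_i`. -/
def fsigma {n : ℕ} (i : ℕ) (h : i + 1 < n) : FreeGroup (VBGen n) := FreeGroup.of (.sigma i h)

/-- The free generator `ρ_i`. -/
def frho {n : ℕ} (i : ℕ) (h : i + 1 < n) : FreeGroup (VBGen n) := FreeGroup.of (.rho i h)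

/-- Relators `u * v⁻¹` for the defining relations `u = v` of the virtual braid group: those of the
braid group, those of the symmetric group, and the mixed ones. -/
inductive VBRel (n : ℕ) : FreeGroup (VBGen n) → Prop
  | sigma_comm (i j : ℕ) (hi : i + 1 < n) (hj : j + 1 < n) (hij : i + 1 < j) :
      VBRel n (fsigma i hi * fsigma j hj * (fsigma j hj * fsigma i hi)⁻¹)
  | sigma_braid (i : ℕ) (hi : i + 1 < n) (hi' : i + 1 + 1 < n) :
      VBRel n (fsigma i hi * fsigma (i + 1) hi' * fsigma i hi *
        (fsigma (i + 1) hi' * fsigma i hi * fsigma (i + 1) hi')⁻¹)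
  | rho_sq (i : ℕ) (hi : i + 1 < n) : VBRel n (frho i hi * frho i hi)
  | rho_comm (i j : ℕ) (hi : i + 1 < n) (hj : j + 1 < n) (hij : i + 1 < j) :
      VBRel n (frho i hi * frho j hj * (frho j hj * frho i hi)⁻¹)
  | rho_braid (i : ℕ) (hi : i + 1 < n) (hi' : i + 1 + 1 < n) :
      VBRel n (frho i hi * frho (i + 1) hi' * frho i hi *
        (frho (i + 1) hi' * frho i hi * frho (i + 1) hi')⁻¹)
  | mixed_comm (i j : ℕ) (hi : i + 1 < n) (hj : j + 1 < n) (hij : i + 1 < j ∨ j + 1 < i) :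
      VBRel n (fsigma i hi * frho j hj * (frho j hj * fsigma i hi)⁻¹)
  | mixed (i : ℕ) (hi : i + 1 < n) (hi' : i + 1 + 1 < n) :
      VBRel n (frho i hi * frho (i + 1) hi' * fsigma i hi *
        (fsigma (i + 1) hi' * frho i hi * frho (i + 1) hi')⁻¹)

/-- The virtual braid group on `n` strands. -/
abbrev VB (n : ℕ) : Type := PresentedGroup {r : FreeGroup (VBGen n) | VBRel n r}

/-- `σ_i` in the virtual braid group. -/
def sigma {n : ℕ} (i : ℕ) (h : i + 1 < n) : VB n := PresentedGroup.of (.sigma i h)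

/-- `ρ_i` in the virtual braid group. -/
def rho {n : ℕ} (i : ℕ) (h : i + 1 < n) : VB n := PresentedGroup.of (.rho i h)

/-- The transposition of the strands `i` and `i + 1`. -/
def transp {n : ℕ} (i : ℕ) (h : i + 1 < n) : Equiv.Perm (Fin n) :=
  Equiv.swap ⟨i, by omega⟩ ⟨i + 1, h⟩

/-- `σ_i` and `ρ_i` both map to the transposition of `i` and `i + 1`. -/
def permGen {n : ℕ} : VBGen n → Equiv.Perm (Fin n)
  | .sigma i h => transp i h
  | .rho i h => transp i h

theorem transp_comm {n : ℕ} (i j : ℕ) (hi : i + 1 < n) (hj : j + 1 < n) (hij : i + 1 < j) :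
    transp i hi * transp j hj = transp j hj * transp i hi := by
  ext x
  simp only [transp, Equiv.Perm.mul_apply, Equiv.swap_apply_def]
  grind

theorem transp_braid {n : ℕ} (i : ℕ) (hi : i + 1 < n) (hi' : i + 1 + 1 < n) :
    transp i hi * transp (i + 1) hi' * transp i hi =
      transp (i + 1) hi' * transp i hi * transp (i + 1) hi' := by
  ext x
  simp only [transp, Equiv.Perm.mul_apply, Equiv.swap_apply_def]
  grind

theorem permGen_rel {n : ℕ} : ∀ r ∈ {r : FreeGroup (VBGen n) | VBRel n r},
    FreeGroup.lift permGen r = 1 := by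
  rintro r hr
  cases hr with
  | sigma_comm i j hi hj hij =>
    rw [map_mul, map_inv, mul_inv_eq_one]
    simpa [fsigma, permGen] using transp_comm i j hi hj hij
  | sigma_braid i hi hi' =>
    rw [map_mul, map_inv, mul_inv_eq_one]
    simpa [fsigma, permGen] using transp_braid i hi hi'
  | rho_sq i hi => simp [frho, permGen, transp]
  | rho_comm i j hi hj hij =>
    rw [map_mul, map_inv, mul_inv_eq_one]
    simpa [frho, permGen] using transp_comm i j hi hj hij
  | rho_braid i hi hi' =>
    rw [map_mul, map_inv, mul_inv_eq_one]
    simpa [frho, permGen] using transp_braid i hi hi'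
  | mixed_comm i j hi hj hij =>
    rw [map_mul, map_inv, mul_inv_eq_one]
    rcases hij with hij | hij
    · simpa [fsigma, frho, permGen] using transp_comm i j hi hj hij
    · simpa [fsigma, frho, permGen] using (transp_comm j i hj hi hij).symm
  | mixed i hi hi' =>
    rw [map_mul, map_inv, mul_inv_eq_one]
    simpa [fsigma, frho, permGen] using transp_braid i hi hi'

/-- The canonical epimorphism from the virtual braid group to the symmetric group. -/
def perm (n : ℕ) : VB n →* Equiv.Perm (Fin n) := PresentedGroup.toGroup permGen_rel

/-- The virtual pure braid group on `n` strands. -/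
abbrev VP (n : ℕ) : Subgroup (VB n) := (perm n).ker

/-- Adding a trivial last strand, on generators. -/
def addStrandGen {n : ℕ} : VBGen n → VB (n + 1)
  | .sigma i h => sigma i (by omega)
  | .rho i h => rho i (by omega)

theorem addStrandGen_rel {n : ℕ} : ∀ r ∈ {r : FreeGroup (VBGen n) | VBRel n r},
    FreeGroup.lift addStrandGen r = 1 := by
  rintro r hr
  cases hr with
  | sigma_comm i j hi hj hij =>
    simpa [fsigma, addStrandGen, sigma, rho, PresentedGroup.of] using PresentedGroup.one_of_mem
      (rels := {r | VBRel (n + 1) r}) (.sigma_comm i j (by omega) (by omega) hij)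
  | sigma_braid i hi hi' =>
    simpa [fsigma, addStrandGen, sigma, rho, PresentedGroup.of] using PresentedGroup.one_of_mem
      (rels := {r | VBRel (n + 1) r}) (.sigma_braid i (by omega) (by omega))
  | rho_sq i hi =>
    simpa [frho, addStrandGen, sigma, rho, PresentedGroup.of] using PresentedGroup.one_of_mem
      (rels := {r | VBRel (n + 1) r}) (.rho_sq i (by omega))
  | rho_comm i j hi hj hij =>
    simpa [frho, addStrandGen, sigma, rho, PresentedGroup.of] using PresentedGroup.one_of_mem
      (rels := {r | VBRel (n + 1) r}) (.rho_comm i j (by omega) (by omega) hij)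
  | rho_braid i hi hi' =>
    simpa [frho, addStrandGen, sigma, rho, PresentedGroup.of] using PresentedGroup.one_of_mem
      (rels := {r | VBRel (n + 1) r}) (.rho_braid i (by omega) (by omega))
  | mixed_comm i j hi hj hij =>
    simpa [fsigma, frho, addStrandGen, sigma, rho, PresentedGroup.of] using PresentedGroup.one_of_mem
      (rels := {r | VBRel (n + 1) r}) (.mixed_comm i j (by omega) (by omega) hij)
  | mixed i hi hi' =>
    simpa [fsigma, frho, addStrandGen, sigma, rho, PresentedGroup.of] using PresentedGroup.one_of_mem
      (rels := {r | VBRel (n + 1) r}) (.mixed i (by omega) (by omega))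

/-- Adding a trivial last strand to a virtual braid. -/
def addStrand (n : ℕ) : VB n →* VB (n + 1) := PresentedGroup.toGroup addStrandGen_rel

/-- `lamUp i d` is `λ_{i, i+1+d}`: `λ_{i, i+1} = ρ_i σ_i⁻¹` and
`λ_{i, j} = ρ_{j-1} ⋯ ρ_{i+1} λ_{i, i+1} ρ_{i+1} ⋯ ρ_{j-1}`. -/
def lamUp {n : ℕ} (i : ℕ) : (d : ℕ) → i + d + 1 < n → VB n
  | 0, h => rho i h * (sigma i h)⁻¹
  | d + 1, h => rho (i + d + 1) h * lamUp i d (by omega) * rho (i + d + 1) h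

/-- `lamDown i d` is `λ_{i+1+d, i}`: `λ_{i+1, i} = σ_i⁻¹ ρ_i` and
`λ_{j, i} = ρ_{j-1} ⋯ ρ_{i+1} λ_{i+1, i} ρ_{i+1} ⋯ ρ_{j-1}`. -/
def lamDown {n : ℕ} (i : ℕ) : (d : ℕ) → i + d + 1 < n → VB n
  | 0, h => (sigma i h)⁻¹ * rho i h
  | d + 1, h => rho (i + d + 1) h * lamDown i d (by omega) * rho (i + d + 1) h

/-- Ordered pairs of distinct strands, indexing the elements `λ_{i,j}`. -/
abbrev Gen (n : ℕ) : Type := {p : Fin n × Fin n // p.1 ≠ p.2}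

/-- The element `λ_{i,j}` as a virtual braid. -/
def lamVB {n : ℕ} (g : Gen n) : VB n :=
  if h : g.1.1 < g.1.2 then
    lamUp g.1.1 (g.1.2 - g.1.1 - 1) (by have := g.1.2.2; have : g.1.1.1 < g.1.2.1 := h; omega)
  else
    lamDown g.1.2 (g.1.1 - g.1.2 - 1) (by
      have := g.1.1.2
      have h1 : ¬ g.1.1.1 < g.1.2.1 := h
      have h2 : g.1.1.1 ≠ g.1.2.1 := fun e => g.2 (Fin.ext e)
      omega)

theorem lamUp_mem {n : ℕ} (i : ℕ) : ∀ (d : ℕ) (h : i + d + 1 < n), lamUp i d h ∈ VP n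
  | 0, h => by
    simp [lamUp, MonoidHom.mem_ker, perm, rho, sigma, permGen]
  | d + 1, h => by
    have ih := lamUp_mem i d (n := n) (by omega)
    rw [MonoidHom.mem_ker] at ih ⊢
    rw [lamUp, map_mul, map_mul, ih]
    simp [perm, rho, permGen, transp]

theorem lamDown_mem {n : ℕ} (i : ℕ) : ∀ (d : ℕ) (h : i + d + 1 < n), lamDown i d h ∈ VP n
  | 0, h => by
    simp [lamDown, MonoidHom.mem_ker, perm, rho, sigma, permGen]
  | d + 1, h => by
    have ih := lamDown_mem i d (n := n) (by omega)
    rw [MonoidHom.mem_ker] at ih ⊢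
    rw [lamDown, map_mul, map_mul, ih]
    simp [perm, rho, permGen, transp]

theorem lamVB_mem {n : ℕ} (g : Gen n) : lamVB g ∈ VP n := by
  unfold lamVB
  split_ifs
  · exact lamUp_mem _ _ _
  · exact lamDown_mem _ _ _

/-- The element `λ_{i,j}` of the virtual pure braid group. -/
def lam {n : ℕ} (g : Gen n) : VP n := ⟨lamVB g, lamVB_mem g⟩

/-- The value in the virtual pure braid group of a word in the letters `λ_{i,j}`. -/
def eval (n : ℕ) : FreeGroup (Gen n) →* VP n := FreeGroup.lift lam

/-- The letter `λ_{a,b}` of the free group, for `a ≠ b` (it is `1`, and never used, for `a = b`). -/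
def X {n : ℕ} (a b : Fin n) : FreeGroup (Gen n) :=
  if h : a ≠ b then FreeGroup.of ⟨(a, b), h⟩ else 1

/-- The standard relators of the virtual pure braid group, distinct letters standing for distinct
indices: `λ_{ij} λ_{kl} = λ_{kl} λ_{ij}` and `λ_{ki} λ_{kj} λ_{ij} = λ_{ij} λ_{kj} λ_{ki}`. -/
def RV (n : ℕ) : Set (FreeGroup (Gen n)) :=
  {r | ∃ i j k l : Fin n, i ≠ j ∧ i ≠ k ∧ i ≠ l ∧ j ≠ k ∧ j ≠ l ∧ k ≠ l ∧
      r = X i j * X k l * (X k l * X i j)⁻¹} ∪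
  {r | ∃ i j k : Fin n, i ≠ j ∧ i ≠ k ∧ j ≠ k ∧
      r = X k i * X k j * X i j * (X i j * X k j * X k i)⁻¹}

/-- Words on `n` strands read as words on `n + 1` strands with a trivial last strand. -/
def inclWord (n : ℕ) : FreeGroup (Gen n) →* FreeGroup (Gen (n + 1)) :=
  FreeGroup.lift fun g => X g.1.1.castSucc g.1.2.castSucc

/-- The word `λ_{0,l} λ_{1,l} ⋯ λ_{k-1,l}` (strands numbered from `0`) on `n + 1` strands. -/
def conjUp {n : ℕ} (k l : Fin n) : FreeGroup (Gen (n + 1)) :=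
  (List.ofFn fun j : Fin k.1 => X (⟨j.1, by omega⟩ : Fin (n + 1)) l.castSucc).prod

/-- The word `λ_{l,0}⁻¹ λ_{l,1}⁻¹ ⋯ λ_{l,k-1}⁻¹` (strands numbered from `0`) on `n + 1` strands. -/
def conjDown {n : ℕ} (k l : Fin n) : FreeGroup (Gen (n + 1)) :=
  (List.ofFn fun j : Fin k.1 => (X l.castSucc (⟨j.1, by omega⟩ : Fin (n + 1)))⁻¹).prod

/-- The word `s_t(λ_{k,l})` for `k < l`. The degeneracy `s_t` doubles the strand `t`, strands being
numbered from `0`. -/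
def degUp {n : ℕ} (t k l : Fin n) : FreeGroup (Gen (n + 1)) :=
  if t < k then X k.succ l.succ
  else if t = k then X k.castSucc l.succ * X k.succ l.succ
  else if t < l then X k.castSucc l.succ
  else if t = l then
    ((conjUp k l)⁻¹ * X k.castSucc l.succ * conjUp k l) * X k.castSucc l.castSucc
  else X k.castSucc l.castSucc

/-- The word `s_t(λ_{l,k})` for `k < l`. -/
def degDown {n : ℕ} (t k l : Fin n) : FreeGroup (Gen (n + 1)) :=
  if t < k then X l.succ k.succ
  else if t = k then X l.succ k.succ * X l.succ k.castSucc
  else if t < l then X l.succ k.castSucc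
  else if t = l then
    X l.castSucc k.castSucc * ((conjDown k l)⁻¹ * X l.succ k.castSucc * conjDown k l)
  else X l.castSucc k.castSucc

/-- The degeneracy `s_t` on words in the letters `λ_{i,j}`. -/
def degWord {n : ℕ} (t : Fin n) : FreeGroup (Gen n) →* FreeGroup (Gen (n + 1)) :=
  FreeGroup.lift fun g =>
    if g.1.1 < g.1.2 then degUp t g.1.1 g.1.2 else degDown t g.1.2 g.1.1

/-- The relators of `RV n`, together with their images under all degeneracies. -/
def cablingRels (n : ℕ) : Set (FreeGroup (Gen (n + 1))) :=
  inclWord n '' RV n ∪ ⋃ t : Fin n, degWord t '' RV n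

end VirtualBraid

/-!
The subgroup of `VB n` generated by the `ρ_i` is a copy of the symmetric group, and conjugation by
it permutes the indices of the `λ_{i,j}`. Conversely, let the symmetric group act on a group
containing a family `λ_{i,j}` by permuting the indices. Then the `ρ_i` and `σ_i = λ_{i,i+1}⁻¹ ρ_i`
satisfy the relations of `VB n` if and only if the `λ_{i,j}` satisfy the standard relations `RV n`:
`σ_i` and `σ_j` commute if and only if `λ_{i,i+1}` and `λ_{j,j+1}` do, and the braid relation of
`σ_i` and `σ_{i+1}` amounts to the relation between `λ_{i,i+1}`, `λ_{i,i+2}` and `λ_{i+1,i+2}`.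
Hence `VB n` is the semidirect product of the group presented by `RV n` and the symmetric group,
and `RV n` is a complete set of relations for `VP n`.

As for the cabling relations, number the strands from `0`. If the conjugations in the words
`s_t(λ_{k,t})` and `s_t(λ_{t,k})` are trivial, then, up to renumbering the other strands, `s_t`
replaces `λ_{a,t}` by `λ_{a,t+1} λ_{a,t}` and `λ_{t,b}` by `λ_{t,b} λ_{t+1,b}`. Given a standard
relation that involves the strand `t`, but not the strand `t + 1`, its image under `s_t` then
implies the same relation with `t + 1` in place of `t`. A relation on `n + 1 ≥ 5` strands involves
at most four of them, so all of them follow by descending induction on a strand that is not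
involved, starting from the last one. The conjugations are trivial by the relations on the first `n`
strands unless `t + 1` is the last strand; in that case the images under `s_t` of commutation
relations and the doublings of earlier strands show one after the other that the conjugating letters
commute with the conjugated one.
-/

namespace VirtualBraid

section StandardRelations

variable {α β Q : Type*} [Group Q]

/-- The family `L a b` satisfies the standard relations of the virtual pure braid group, as far as
they only involve strands in `s`. The values `L a a` are irrelevant. -/
structure IsPureOn (s : Set α) (L : α → α → Q) : Prop where
  comm {i j k l : α} : i ∈ s → j ∈ s → k ∈ s → l ∈ s → [i, j, k, l].Nodup →
    Commute (L i j) (L k l)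
  triple {i j k : α} : i ∈ s → j ∈ s → k ∈ s → [i, j, k].Nodup →
    L k i * L k j * L i j = L i j * L k j * L k i

/-- The family `L a b` satisfies all the standard relations of the virtual pure braid group. -/
abbrev IsPure (L : α → α → Q) : Prop := IsPureOn Set.univ L

namespace IsPureOn

variable {s : Set α} {L M : α → α → Q}

theorem mono {t : Set α} (h : IsPureOn t L) (hst : s ⊆ t) : IsPureOn s L where
  comm hi hj hk hl := h.comm (hst hi) (hst hj) (hst hk) (hst hl)
  triple hi hj hk := h.triple (hst hi) (hst hj) (hst hk)

theorem congr (h : IsPureOn s L) (hLM : ∀ a ∈ s, ∀ b ∈ s, a ≠ b → L a b = M a b) :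
    IsPureOn s M where
  comm {i j k l} hi hj hk hl hd := by
    rw [← hLM i hi j hj (by grind), ← hLM k hk l hl (by grind)]
    exact h.comm hi hj hk hl hd
  triple {i j k} hi hj hk hd := by
    rw [← hLM k hk i hi (by grind), ← hLM k hk j hj (by grind), ← hLM i hi j hj (by grind)]
    exact h.triple hi hj hk hd

/-- The symmetry `λ_{ij} ↦ λ_{ji}⁻¹` comes from the automorphism `σ_i ↦ σ_i⁻¹`, `ρ_i ↦ ρ_i`. -/
theorem swap_inv (h : IsPureOn s L) : IsPureOn s fun a b => (L b a)⁻¹ where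
  comm hi hj hk hl hd := (h.comm hj hi hl hk (by grind)).inv_inv
  triple hi hj hk hd := by
    simpa [mul_assoc] using congrArg (·⁻¹) (h.triple hi hk hj (by grind))

end IsPureOn

theorem IsPure.comm {L : α → α → Q} (h : IsPure L) {i j k l : α} (hd : [i, j, k, l].Nodup) :
    Commute (L i j) (L k l) :=
  IsPureOn.comm h trivial trivial trivial trivial hd

theorem IsPure.triple {L : α → α → Q} (h : IsPure L) {i j k : α} (hd : [i, j, k].Nodup) :
    L k i * L k j * L i j = L i j * L k j * L k i :=
  IsPureOn.triple h trivial trivial trivial hd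

theorem isPureOn_range_iff {φ : α → β} (hφ : Function.Injective φ) {L : β → β → Q} :
    IsPureOn (Set.range φ) L ↔ IsPure fun a b => L (φ a) (φ b) where
  mp h :=
    { comm := fun _ _ _ _ hd => h.comm ⟨_, rfl⟩ ⟨_, rfl⟩ ⟨_, rfl⟩ ⟨_, rfl⟩ (hd.map hφ)
      triple := fun _ _ _ hd => h.triple ⟨_, rfl⟩ ⟨_, rfl⟩ ⟨_, rfl⟩ (hd.map hφ) }
  mpr h :=
    { comm := by
        rintro _ _ _ _ ⟨i, rfl⟩ ⟨j, rfl⟩ ⟨k, rfl⟩ ⟨l, rfl⟩ hd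
        exact h.comm (.of_map φ hd)
      triple := by
        rintro _ _ _ ⟨i, rfl⟩ ⟨j, rfl⟩ ⟨k, rfl⟩ hd
        exact h.triple (.of_map φ hd) }

theorem map_mul_inv_eq_one {G : Type*} [Group G] (f : G →* Q) {u v : G} :
    f (u * v⁻¹) = 1 ↔ f u = f v := by
  rw [map_mul, map_inv, mul_inv_eq_one]

section FreeGroup

variable {n : ℕ}

theorem freeGroup_hom_ext {f g : FreeGroup (Gen n) →* Q}
    (h : ∀ a b, a ≠ b → f (X a b) = g (X a b)) : f = g :=
  FreeGroup.ext_hom _ _ fun x => by simpa [X, x.2] using h x.1.1 x.1.2 x.2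

theorem lift_X (L : Fin n → Fin n → Q) {a b : Fin n} (hab : a ≠ b) :
    FreeGroup.lift (fun g : Gen n => L g.1.1 g.1.2) (X a b) = L a b := by
  simp [X, hab]

theorem IsPure.isPure_lift_X {L : Fin n → Fin n → Q} (h : IsPure L) :
    IsPure fun a b => FreeGroup.lift (fun g : Gen n => L g.1.1 g.1.2) (X a b) :=
  h.congr fun _ _ _ _ hab => (lift_X L hab).symm

theorem inclWord_X {a b : Fin n} (hab : a ≠ b) :
    inclWord n (X a b) = X a.castSucc b.castSucc :=
  lift_X (fun a b => X a.castSucc b.castSucc) hab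

theorem isPure_iff (f : FreeGroup (Gen n) →* Q) :
    (∀ r ∈ RV n, f r = 1) ↔ IsPure fun a b => f (X a b) := by
  refine ⟨fun h => ⟨fun {i j k l} _ _ _ _ hd => ?_, fun {i j k} _ _ _ hd => ?_⟩, ?_⟩
  · simpa only [commute_iff_eq, map_mul] using (map_mul_inv_eq_one f).1 <|
      h _ (.inl ⟨i, j, k, l, by grind, by grind, by grind, by grind, by grind, by grind, rfl⟩)
  · simpa only [map_mul] using (map_mul_inv_eq_one f).1 <|
      h _ (.inr ⟨i, j, k, by grind, by grind, by grind, rfl⟩)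
  · rintro h r (⟨i, j, k, l, _, _, _, _, _, _, rfl⟩ | ⟨i, j, k, _, _, _, rfl⟩) <;>
      rw [map_mul_inv_eq_one]
    · simpa only [map_mul] using
        (h.comm (i := i) (j := j) (k := k) (l := l) (by grind)).eq
    · simpa only [map_mul] using
        h.triple (i := i) (j := j) (k := k) (by grind)

end FreeGroup

section GroupIdentities

variable {a a' b b' c : Q}

theorem triple_double_first (h : a * b * c = c * b * a) (h' : a' * b' * c = c * b' * a')
    (hb : Commute a' b) (ha : Commute b' a) : a * a' * (b * b') * c = c * (b * b') * (a * a') := by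
  calc a * a' * (b * b') * c = a * (a' * b) * b' * c := by group
    _ = a * b * (a' * b' * c) := by rw [hb.eq]; group
    _ = a * b * c * b' * a' := by rw [h']; group
    _ = c * b * (a * b') * a' := by rw [h]; group
    _ = c * (b * b') * (a * a') := by rw [← ha.eq]; group

theorem triple_of_double_first (h : a * b * c = c * b * a) (hb : Commute a' b) (ha : Commute b' a)
    (hd : a * a' * (b * b') * c = c * (b * b') * (a * a')) : a' * b' * c = c * b' * a' := by
  refine mul_left_cancel (a := a * b) ?_
  calc a * b * (a' * b' * c) = a * (b * a') * b' * c := by group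
    _ = a * a' * (b * b') * c := by rw [← hb.eq]; group
    _ = c * b * (b' * a) * a' := by rw [hd]; group
    _ = c * b * a * b' * a' := by rw [ha.eq]; group
    _ = a * b * (c * b' * a') := by rw [← h]; group

theorem triple_of_double_last (h' : a' * b' * c = c * b' * a') (hb : Commute a' b)
    (ha : Commute b' a) (hd : a * a' * (b * b') * c = c * (b * b') * (a * a')) :
    a * b * c = c * b * a := by
  refine mul_right_cancel (b := b' * a') ?_
  calc a * b * c * (b' * a') = a * b * (c * b' * a') := by group
    _ = a * (b * a') * b' * c := by rw [← h']; group
    _ = a * a' * (b * b') * c := by rw [← hb.eq]; group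
    _ = c * b * (b' * a) * a' := by rw [hd]; group
    _ = c * b * a * (b' * a') := by rw [ha.eq]; group

theorem triple_double_middle (h : a * c * b = b * c * a) (h' : a' * c * b' = b' * c * a')
    (hb : Commute a' b) (ha : Commute a b') : a' * a * c * (b * b') = b * b' * c * (a' * a) := by
  calc a' * a * c * (b * b') = a' * (a * c * b) * b' := by group
    _ = (a' * b) * c * (a * b') := by rw [h]; group
    _ = b * (a' * c * b') * a := by rw [hb.eq, ha.eq]; group
    _ = b * b' * c * (a' * a) := by rw [h']; group

theorem triple_of_double_middle (h : a * c * b = b * c * a) (hb : Commute a' b) (ha : Commute a b')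
    (hd : a' * a * c * (b * b') = b * b' * c * (a' * a)) : a' * c * b' = b' * c * a' := by
  refine mul_left_cancel (a := b) (mul_right_cancel (b := a) ?_)
  calc b * (a' * c * b') * a = (b * a') * c * (b' * a) := by group
    _ = a' * (b * c * a) * b' := by rw [← hb.eq, ← ha.eq]; group
    _ = a' * a * c * (b * b') := by rw [← h]; group
    _ = b * (b' * c * a') * a := by rw [hd]; group

theorem commute_mul_left_iff {x y z : Q} (h : Commute y z) : Commute (x * y) z ↔ Commute x z :=
  ⟨fun hxy => by simpa using hxy.mul_left h.inv_left, fun hx => hx.mul_left h⟩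

theorem commute_mul_right_iff {x y z : Q} (h : Commute x z) : Commute x (y * z) ↔ Commute x y :=
  ⟨fun hxy => by simpa using hxy.mul_right h.inv_right, fun hx => hx.mul_right h⟩

theorem inv_mul_braid {a b c p q : Q} (hpc : SemiconjBy p c b) (hqa : SemiconjBy q a b)
    (hpb : SemiconjBy p b c) :
    a⁻¹ * p * (c⁻¹ * q) * (a⁻¹ * p) = (c * b * a)⁻¹ * (p * q * p) := by
  calc a⁻¹ * p * (c⁻¹ * q) * (a⁻¹ * p) = a⁻¹ * (p * c⁻¹) * (q * a⁻¹) * p := by group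
    _ = a⁻¹ * b⁻¹ * (p * b⁻¹) * q * p := by rw [hpc.inv_right.eq, hqa.inv_right.eq]; group
    _ = (c * b * a)⁻¹ * (p * q * p) := by rw [hpb.inv_right.eq]; group

end GroupIdentities

section Cable

variable [DecidableEq α] {p q : α} {L : α → α → Q}

/-- The effect on a family `λ_{ab}` of doubling the strand `p` by means of a parallel strand `q`:
the result is a family on the strands other than `q`. -/
def cable (p q : α) (L : α → α → Q) (a b : α) : Q :=
  if a = p then L p b * L q b else if b = p then L a q * L a p else L a b

theorem cable_left (b : α) : cable p q L p b = L p b * L q b := if_pos rfl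

theorem cable_right {a : α} (ha : a ≠ p) : cable p q L a p = L a q * L a p := by
  simp [cable, ha]

theorem cable_of_ne {a b : α} (ha : a ≠ p) (hb : b ≠ p) : cable p q L a b = L a b := by
  simp [cable, ha, hb]

theorem cable_swap_inv {a b : α} (hab : a ≠ b) :
    cable p q (fun a b => (L b a)⁻¹) a b = (cable p q L b a)⁻¹ := by
  unfold cable
  grind [mul_inv_rev]

end Cable

end StandardRelations

section Doubling

variable {α Q : Type*} [Group Q]

variable [DecidableEq α] {p q : α} {L : α → α → Q}

theorem IsPure.commute_cable (h : IsPure L) {i j k l : α} (hd : [i, j, k, l].Nodup)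
    (hq : q ∉ [i, j, k, l]) (hk : k ≠ p) (hl : l ≠ p) :
    Commute (cable p q L i j) (cable p q L k l) := by
  rw [cable_of_ne hk hl]
  rcases eq_or_ne i p with rfl | hi
  · rw [cable_left]
    exact (h.comm hd).mul_left (h.comm (by grind))
  rcases eq_or_ne j p with rfl | hj
  · rw [cable_right hi]
    exact (h.comm (by grind)).mul_left (h.comm hd)
  rw [cable_of_ne hi hj]
  exact h.comm hd

theorem IsPure.triple_cable (h : IsPure L) {i j k : α} (hd : [q, i, j, k].Nodup) :
    cable p q L k i * cable p q L k j * cable p q L i j =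
      cable p q L i j * cable p q L k j * cable p q L k i := by
  rcases eq_or_ne k p with rfl | hk
  · rw [cable_left, cable_left, cable_of_ne (by grind) (by grind)]
    exact triple_double_first (h.triple (by grind)) (h.triple (by grind)) (h.comm (by grind))
      (h.comm (by grind))
  rcases eq_or_ne i p with rfl | hi
  · rw [cable_left, cable_right hk, cable_of_ne hk (by grind)]
    exact triple_double_middle (h.triple (by grind)) (h.triple (by grind)) (h.comm (by grind))
      (h.comm (by grind))
  rcases eq_or_ne j p with rfl | hj
  · rw [cable_right hi, cable_right hk, cable_of_ne hk hi]
    exact (triple_double_first (h.triple (by grind)).symm (h.triple (by grind)).symm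
      (h.comm (by grind)) (h.comm (by grind))).symm
  rw [cable_of_ne hk hi, cable_of_ne hk hj, cable_of_ne hi hj]
  exact h.triple (by grind)

theorem IsPure.isPureOn_cable (h : IsPure L) : IsPureOn {q}ᶜ (cable p q L) where
  comm {i j k l} hi hj hk hl hd := by
    by_cases hp : k = p ∨ l = p
    · exact (h.commute_cable (by grind) (by grind) (by grind) (by grind)).symm
    · exact h.commute_cable hd (by grind) (by grind) (by grind)
  triple hi hj hk hd := h.triple_cable (by grind)

section OfCable

variable (hc : IsPureOn {q}ᶜ (cable p q L))
include hc

theorem IsPureOn.commute_mul_left {j k l : α} (hd : [p, q, j, k, l].Nodup) :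
    Commute (L p j * L q j) (L k l) := by
  have := hc.comm (i := p) (j := j) (k := k) (l := l)
  rw [cable_left, cable_of_ne (by grind) (by grind)] at this
  grind

theorem IsPureOn.commute_mul_right {j k l : α} (hd : [p, q, j, k, l].Nodup) :
    Commute (L j q * L j p) (L k l) := by
  have := hc.comm (i := j) (j := p) (k := k) (l := l)
  rw [cable_right (by grind), cable_of_ne (by grind) (by grind)] at this
  grind

theorem commute_of_cable_left {j k l : α} (hd : [p, q, j, k, l].Nodup)
    (h : Commute (L p j) (L k l)) : Commute (L q j) (L k l) := by
  simpa using h.inv_left.mul_left (hc.commute_mul_left hd)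

theorem commute_of_cable_right {j k l : α} (hd : [p, q, j, k, l].Nodup)
    (h : Commute (L j p) (L k l)) : Commute (L j q) (L k l) := by
  simpa using (hc.commute_mul_right hd).mul_left h.inv_left

theorem commute_of_cable
    (h : ∀ i j k l, [q, i, j, k, l].Nodup → Commute (L i j) (L k l))
    (i j k l : α) (hd : [p, i, j, k, l].Nodup) : Commute (L i j) (L k l) := by
  rcases eq_or_ne i q with rfl | hi
  · exact commute_of_cable_left hc hd (h _ _ _ _ (by grind))
  rcases eq_or_ne j q with rfl | hj
  · exact commute_of_cable_right hc (by grind) (h _ _ _ _ (by grind))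
  rcases eq_or_ne k q with rfl | hk
  · exact (commute_of_cable_left hc (by grind) (h _ _ _ _ (by grind))).symm
  rcases eq_or_ne l q with rfl | hl
  · exact (commute_of_cable_right hc (by grind) (h _ _ _ _ (by grind))).symm
  exact h _ _ _ _ (by grind)

theorem triple_of_cable
    (hcomm : ∀ i j k l, [i, j, k, l].Nodup → Commute (L i j) (L k l))
    (h : ∀ i j k, [q, i, j, k].Nodup → L k i * L k j * L i j = L i j * L k j * L k i)
    (i j k : α) (hd : [p, i, j, k].Nodup) : L k i * L k j * L i j = L i j * L k j * L k i := by
  rcases eq_or_ne k q with rfl | hk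
  · have := hc.triple (i := i) (j := j) (k := p) (by grind) (by grind) (by grind) (by grind)
    rw [cable_left, cable_left, cable_of_ne (by grind) (by grind)] at this
    exact triple_of_double_first (h _ _ _ (by grind)) (hcomm _ _ _ _ (by grind))
      (hcomm _ _ _ _ (by grind)) this
  rcases eq_or_ne i q with rfl | hi
  · have := hc.triple (i := p) (j := j) (k := k) (by grind) (by grind) (by grind) (by grind)
    rw [cable_left, cable_right (by grind), cable_of_ne (by grind) (by grind)] at this
    exact triple_of_double_middle (h _ _ _ (by grind)) (hcomm _ _ _ _ (by grind))
      (hcomm _ _ _ _ (by grind)) this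
  rcases eq_or_ne j q with rfl | hj
  · have := hc.triple (i := i) (j := p) (k := k) (by grind) (by grind) (by grind) (by grind)
    rw [cable_right (by grind), cable_right (by grind), cable_of_ne (by grind) (by grind)] at this
    exact (triple_of_double_last (h _ _ _ (by grind)).symm (hcomm _ _ _ _ (by grind))
      (hcomm _ _ _ _ (by grind)) this.symm).symm
  exact h _ _ _ (by grind)

end OfCable

theorem exists_nodup_cons {n : ℕ} {l : List (Fin n)} (hl : l.Nodup) (h : l.length < n) :
    ∃ m, (m :: l).Nodup := by
  have : l.toFinset.card < (Finset.univ : Finset (Fin n)).card := by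
    simpa using (List.toFinset_card_le l).trans_lt h
  obtain ⟨m, -, hm⟩ := Finset.exists_mem_notMem_of_card_lt_card this
  exact ⟨m, by simpa [hl] using hm⟩

/-- Each relation misses some strand. If this is the last one, the relation is among `h0`; otherwise
`hc` reduces it to relations missing the next strand. -/
theorem isPure_of_isPureOn_cable {n : ℕ} (hn : 4 ≤ n) {L : Fin (n + 1) → Fin (n + 1) → Q}
    (h0 : IsPureOn {Fin.last n}ᶜ L)
    (hc : ∀ t : Fin n, IsPureOn {t.succ}ᶜ (cable t.castSucc t.succ L)) : IsPure L := by
  have comm_missing (m : Fin (n + 1)) :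
      ∀ i j k l, [m, i, j, k, l].Nodup → Commute (L i j) (L k l) := by
    induction m using Fin.reverseInduction with
    | last => exact fun i j k l hd => h0.comm (by grind) (by grind) (by grind) (by grind) hd.of_cons
    | cast t ih => exact commute_of_cable (hc t) ih
  have comm : ∀ i j k l, [i, j, k, l].Nodup → Commute (L i j) (L k l) := fun i j k l hd =>
    have ⟨m, hm⟩ := exists_nodup_cons hd (by simp; omega)
    comm_missing m i j k l hm
  have triple_missing (m : Fin (n + 1)) :
      ∀ i j k, [m, i, j, k].Nodup → L k i * L k j * L i j = L i j * L k j * L k i := by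
    induction m using Fin.reverseInduction with
    | last => exact fun i j k hd => h0.triple (by grind) (by grind) (by grind) hd.of_cons
    | cast t ih => exact triple_of_cable (hc t) comm ih
  refine ⟨fun _ _ _ _ hd => comm _ _ _ _ hd, fun {i j k} _ _ _ hd => ?_⟩
  obtain ⟨m, hm⟩ := exists_nodup_cons hd (by simp; omega)
  exact triple_missing m i j k hm

end Doubling

section Degeneracies

variable {α Q : Type*} [Group Q]

/-- The first `z i` commutes with the product of the remaining `a j`, hence with
`(a i)⁻¹ * x * a i`, which equals `z i * x * (z i)⁻¹` because `x` commutes with `a i * z i`. -/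
theorem commute_of_commute_prod_conj {ι : Type*} {x : Q} {a z : ι → Q} {l : List ι}
    (hza : l.Pairwise fun i j => Commute (z i) (a j)) (hx : ∀ i ∈ l, Commute x (a i * z i))
    (hz : ∀ i ∈ l, Commute (z i) ((l.map a).prod⁻¹ * x * (l.map a).prod)) :
    ∀ i ∈ l, Commute x (a i) := by
  induction l with
  | nil => simp
  | cons i l ih =>
    simp only [List.pairwise_cons, List.forall_mem_cons, List.map_cons, List.prod_cons] at *
    set P := (l.map a).prod
    have conj_eq : (a i)⁻¹ * x * a i = z i * x * (z i)⁻¹ := by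
      have := hx.1.eq
      rw [mul_assoc, inv_mul_eq_iff_eq_mul, ← mul_assoc, ← mul_assoc, eq_mul_inv_iff_mul_eq,
        ← this, mul_assoc]
    have hzP : Commute (z i) P :=
      Commute.list_prod_right _ _ (List.forall_mem_map.2 hza.1)
    have hzx : Commute (z i) x := by
      have : Commute (z i) (P * ((a i * P)⁻¹ * x * (a i * P)) * P⁻¹) :=
        (hzP.mul_right hz.1).mul_right hzP.inv_right
      rw [show P * ((a i * P)⁻¹ * x * (a i * P)) * P⁻¹ = z i * x * (z i)⁻¹ by
        rw [← conj_eq]; group] at this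
      exact mul_inv_eq_iff_eq_mul.1 (by simpa [commute_iff_eq, mul_assoc] using this)
    have hxa : Commute x (a i) := by simpa using hx.1.mul_right hzx.symm.inv_right
    have hconj : (a i * P)⁻¹ * x * (a i * P) = P⁻¹ * x * P := by
      rw [mul_inv_rev, mul_assoc P⁻¹, mul_assoc P⁻¹, mul_assoc P⁻¹, ← mul_assoc _ (a i),
        mul_assoc _ x, hxa.eq, inv_mul_cancel_left]
    exact ⟨hxa, ih hza.2 hx.2 fun j hj => hconj ▸ hz.2 j hj⟩

theorem IsPureOn.commute_of_commute_prod_conj [DecidableEq α] {p q r k : α} {L : α → α → Q}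
    (h0 : IsPureOn {q}ᶜ L) (hc : IsPureOn {p}ᶜ (cable r p L)) {l : List α}
    (hd : (k :: p :: q :: r :: l).Nodup)
    (hz : ∀ j ∈ l,
      Commute (L j r) ((l.map (L · p)).prod⁻¹ * L k q * (l.map (L · p)).prod)) :
    ∀ j ∈ l, Commute (L k q) (L j p) := by
  refine VirtualBraid.commute_of_commute_prod_conj (z := (L · r)) ?_ (fun j hj => ?_) hz
  · refine List.Pairwise.imp_of_mem (R := (· ≠ ·)) (fun {i j} hi hj hij => ?_) (by grind)
    exact h0.comm (by grind) (by grind) (by grind) (by grind) (by grind)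
  · exact (hc.commute_mul_right (by grind)).symm

section Words

variable {n : ℕ}

/-- The symmetry `λ_{ij} ↦ λ_{ji}⁻¹` on words. -/
def swapInv (n : ℕ) : FreeGroup (Gen n) →* FreeGroup (Gen n) :=
  FreeGroup.lift fun g => (X g.1.2 g.1.1)⁻¹

theorem swapInv_X (a b : Fin n) : swapInv n (X a b) = (X b a)⁻¹ := by
  rcases eq_or_ne a b with rfl | hab
  · simp [X]
  · simp [swapInv, X, hab]

theorem swapInv_conjUp (k l : Fin n) : swapInv (n + 1) (conjUp k l) = conjDown k l := by
  simp [conjUp, conjDown, map_list_prod, List.map_ofFn, Function.comp_def, swapInv_X]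

theorem swapInv_conjDown (k l : Fin n) : swapInv (n + 1) (conjDown k l) = conjUp k l := by
  simp [conjUp, conjDown, map_list_prod, List.map_ofFn, Function.comp_def, swapInv_X]

theorem degWord_of_lt {t a b : Fin n} (h : a < b) : degWord t (X a b) = degUp t a b := by
  simp [degWord, X, h, h.ne]

theorem degWord_of_gt {t a b : Fin n} (h : b < a) : degWord t (X a b) = degDown t b a := by
  simp [degWord, X, h.not_gt, h.ne']

theorem swapInv_degWord (t : Fin n) {a b : Fin n} (hab : a ≠ b) :
    swapInv (n + 1) (degWord t (X a b)) = (degWord t (X b a))⁻¹ := by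
  rcases lt_or_gt_of_ne hab with h | h
  · rw [degWord_of_lt h, degWord_of_gt h, degUp, degDown]
    split_ifs <;> simp [swapInv_X, swapInv_conjUp, mul_assoc]
  · rw [degWord_of_lt h, degWord_of_gt h, degUp, degDown]
    split_ifs <;> simp [swapInv_X, swapInv_conjDown, mul_assoc]

theorem degWord_of_lt_of_lt {t a b : Fin n} (hab : a < b) (hbt : b < t) :
    degWord t (X a b) = X a.castSucc b.castSucc := by
  rw [degWord_of_lt hab, degUp]
  grind

theorem degWord_self {t k : Fin n} (h : k < t) :
    degWord t (X k t) =
      (conjUp k t)⁻¹ * X k.castSucc t.succ * conjUp k t * X k.castSucc t.castSucc := by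
  rw [degWord_of_lt h, degUp]
  grind

/-- The conjugations in the words `s_t(λ_{k,t})`, `k < t`, become trivial under `f`. -/
def IsUntwisted (f : FreeGroup (Gen (n + 1)) →* Q) (t : Fin n) : Prop :=
  ∀ j k : Fin n, j < k → k < t →
    Commute (f (X k.castSucc t.succ)) (f (X j.castSucc t.castSucc))

variable {f : FreeGroup (Gen (n + 1)) →* Q} {t : Fin n}

theorem IsPureOn.isUntwisted {s : Set (Fin (n + 1))} (h : IsPureOn s fun a b => f (X a b))
    (hs : ∀ a ≤ t.succ, a ∈ s) : IsUntwisted f t := by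
  intro j k hjk hkt
  exact h.comm (hs _ (by grind)) (hs _ (by grind)) (hs _ (by grind)) (hs _ (by grind)) (by grind)

theorem IsUntwisted.commute_conjUp (h : IsUntwisted f t) {k : Fin n} (hk : k < t) :
    Commute (f (X k.castSucc t.succ)) (f (conjUp k t)) := by
  rw [conjUp, map_list_prod]
  refine Commute.list_prod_right _ _ fun x hx => ?_
  simp only [List.map_ofFn, List.mem_ofFn, Function.comp_apply] at hx
  obtain ⟨j, rfl⟩ := hx
  exact h ⟨j, by omega⟩ k j.2 hk

theorem IsUntwisted.map_degWord_of_lt (h : IsUntwisted f t) {a b : Fin n} (hab : a < b) :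
    f (degWord t (X a b)) = cable t.castSucc t.succ (fun a b => f (X a b))
      (t.succ.succAbove a) (t.succ.succAbove b) := by
  have succAbove_lt {c : Fin n} (hc : c < t) : t.succ.succAbove c = c.castSucc :=
    Fin.succAbove_of_castSucc_lt _ _ (by grind)
  have succAbove_gt {c : Fin n} (hc : t < c) : t.succ.succAbove c = c.succ :=
    Fin.succAbove_of_le_castSucc _ _ (by grind)
  rw [degWord_of_lt hab, degUp]
  split_ifs with hta hta' htb htb'
  · rw [succAbove_gt hta, succAbove_gt (hta.trans hab), cable_of_ne (by grind) (by grind)]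
  · subst hta'
    rw [Fin.succAbove_succ_self, succAbove_gt hab, cable_left, map_mul]
  · rw [succAbove_lt (by grind), succAbove_gt htb, cable_of_ne (by grind) (by grind)]
  · subst htb'
    rw [Fin.succAbove_succ_self, succAbove_lt hab, cable_right (by grind), map_mul, map_mul,
      map_mul, map_inv, mul_assoc _ (f (X _ _)), (h.commute_conjUp hab).eq, inv_mul_cancel_left]
  · rw [succAbove_lt (by grind), succAbove_lt (by grind), cable_of_ne (by grind) (by grind)]

end Words

end Degeneracies

section CablingRelations

variable {Q : Type*} [Group Q] {n : ℕ} {f : FreeGroup (Gen (n + 1)) →* Q} {t : Fin n}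

theorem map_degWord (h : IsUntwisted f t) (h' : IsUntwisted (f.comp (swapInv (n + 1))) t)
    {a b : Fin n} (hab : a ≠ b) :
    f (degWord t (X a b)) = cable t.castSucc t.succ (fun a b => f (X a b))
      (t.succ.succAbove a) (t.succ.succAbove b) := by
  rcases lt_or_gt_of_ne hab with hlt | hgt
  · exact h.map_degWord_of_lt hlt
  · have := h'.map_degWord_of_lt hgt
    simp only [MonoidHom.comp_apply, swapInv_degWord t hab.symm, swapInv_X, map_inv] at this
    rwa [cable_swap_inv (by simpa using hab.symm), inv_inj] at this

theorem isPure_degWord_iff (h : IsUntwisted f t)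
    (h' : IsUntwisted (f.comp (swapInv (n + 1))) t) :
    (IsPure fun a b => f (degWord t (X a b))) ↔
      IsPureOn {t.succ}ᶜ (cable t.castSucc t.succ fun a b => f (X a b)) := by
  rw [← Fin.range_succAbove, isPureOn_range_iff Fin.succAbove_right_injective]
  exact ⟨fun H => H.congr fun a _ b _ hab => map_degWord h h' hab,
    fun H => H.congr fun a _ b _ hab => (map_degWord h h' hab).symm⟩

/-- The relators of `cablingRels n` are trivial under `f`. -/
structure IsCabled (f : FreeGroup (Gen (n + 1)) →* Q) : Prop where
  incl : IsPureOn {Fin.last n}ᶜ fun a b => f (X a b)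
  deg (t : Fin n) : IsPure fun a b => f (degWord t (X a b))

theorem isCabled_iff : (∀ r ∈ cablingRels n, f r = 1) ↔ IsCabled f := by
  have incl_iff : (∀ r ∈ inclWord n '' RV n, f r = 1) ↔
      IsPureOn {Fin.last n}ᶜ fun a b => f (X a b) := by
    rw [Set.forall_mem_image, ← Fin.range_succAbove, Fin.succAbove_last,
      isPureOn_range_iff (Fin.castSucc_injective n)]
    refine (isPure_iff (f.comp (inclWord n))).trans ⟨?_, ?_⟩ <;>
      refine fun h => h.congr fun a _ b _ hab => ?_ <;> rw [MonoidHom.comp_apply, inclWord_X hab]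
  have deg_iff (t : Fin n) : (∀ r ∈ degWord t '' RV n, f r = 1) ↔
      IsPure fun a b => f (degWord t (X a b)) := by
    rw [Set.forall_mem_image]
    exact isPure_iff (f.comp (degWord t))
  simp only [cablingRels, Set.mem_union, Set.mem_iUnion, or_imp, forall_and, forall_exists_index]
  rw [incl_iff, forall_comm]
  simp only [deg_iff]
  exact ⟨fun h => ⟨h.1, h.2⟩, fun h => ⟨h.1, h.2⟩⟩

theorem IsPure.isCabled (h : IsPure fun a b => f (X a b)) : IsCabled f where
  incl := h.mono (Set.subset_univ _)
  deg _ := (isPure_degWord_iff (h.isUntwisted fun _ _ => trivial)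
    (IsPureOn.isUntwisted (s := Set.univ) (by simpa [swapInv_X] using h.swap_inv)
      fun _ _ => trivial)).2 h.isPureOn_cable

namespace IsCabled

variable (h : IsCabled f)
include h

theorem comp_swapInv : IsCabled (f.comp (swapInv (n + 1))) where
  incl := by simpa [swapInv_X] using h.incl.swap_inv
  deg t := (h.deg t).swap_inv.congr fun a _ b _ hab => by simp [swapInv_degWord t hab]

theorem isUntwisted_of_lt (ht : t.succ < Fin.last n) : IsUntwisted f t :=
  h.incl.isUntwisted fun a ha => by simpa using (ha.trans_lt ht).ne

theorem isPureOn_cable_of_lt (ht : t.succ < Fin.last n) :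
    IsPureOn {t.succ}ᶜ (cable t.castSucc t.succ fun a b => f (X a b)) :=
  (isPure_degWord_iff (h.isUntwisted_of_lt ht) (h.comp_swapInv.isUntwisted_of_lt ht)).1 (h.deg t)

theorem commute_conj {j r k : Fin n} (hjr : j < r) (hrt : r < t) (hkt : k < t)
    (hd : [j, r, k].Nodup) :
    Commute (f (X j.castSucc r.castSucc))
      (f ((conjUp k t)⁻¹ * X k.castSucc t.succ * conjUp k t)) := by
  have hdeg := (h.deg t).comm (i := j) (j := r) (k := k) (l := t) (by grind)
  simp only [degWord_of_lt_of_lt hjr hrt, degWord_self hkt, map_mul] at hdeg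
  have hincl := h.incl.comm (i := j.castSucc) (j := r.castSucc) (k := k.castSucc)
    (l := t.castSucc) (by grind) (by grind) (by grind) (by grind) (by grind)
  simpa using hdeg.mul_right hincl.inv_right

theorem commute_of_lt {r j k : Fin n} (ht : t.succ = Fin.last n) (hr : r.succ = t.castSucc)
    (hjk : j < k) (hkr : k < r) :
    Commute (f (X k.castSucc t.succ)) (f (X j.castSucc t.castSucc)) := by
  let below : List (Fin (n + 1)) := (List.finRange k).map fun i => (i.castLE k.2.le).castSucc
  have mem_below {a : Fin (n + 1)} : a ∈ below ↔ a < k.castSucc := by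
    simp only [below, List.mem_map, List.mem_finRange, true_and]
    exact ⟨by rintro ⟨i, rfl⟩; exact i.2, fun ha => ⟨⟨a, ha⟩, rfl⟩⟩
  have nodup_below : below.Nodup := (List.nodup_finRange k).map fun i i' hi => by
    simpa [Fin.ext_iff] using hi
  have map_conjUp : f (conjUp k t) = (below.map fun a => f (X a t.castSucc)).prod := by
    rw [conjUp, map_list_prod, List.ofFn_eq_map, List.map_map, List.map_map]
    rfl
  have hcable := h.isPureOn_cable_of_lt (t := r) (by grind)
  rw [hr] at hcable
  clear_value below
  have nodup : (k.castSucc :: t.castSucc :: t.succ :: r.castSucc :: below).Nodup := by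
    simp only [List.nodup_cons, List.mem_cons, mem_below]
    grind
  refine (ht ▸ h.incl).commute_of_commute_prod_conj hcable nodup (fun a ha => ?_)
    _ (mem_below.2 hjk)
  rw [mem_below] at ha
  have hconj := h.commute_conj (j := ⟨a, by grind⟩) (r := r) (k := k) (t := t) (by grind) (by grind)
    (by grind) (by grind)
  simpa [map_conjUp] using hconj

theorem isUntwisted (hn : 4 ≤ n) (t : Fin n) : IsUntwisted f t := by
  rcases (Fin.le_last t.succ).lt_or_eq with ht | ht
  · exact h.isUntwisted_of_lt ht
  intro j k hjk hkt
  obtain ⟨r, hr⟩ : ∃ r : Fin n, r.succ = t.castSucc := ⟨⟨t - 1, by omega⟩, by grind⟩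
  rcases (show k ≤ r by grind).lt_or_eq with hkr | rfl
  · exact h.commute_of_lt ht hr hjk hkr
  obtain ⟨s, hs⟩ : ∃ s : Fin n, s.succ = k.castSucc := ⟨⟨k - 1, by omega⟩, by grind⟩
  have hsk : s < k := by grind
  have hcable_s := h.isPureOn_cable_of_lt (t := s) (by grind)
  rw [hs] at hcable_s
  have of_lt {i : Fin n} (hi : i < s) :
      Commute (f (X k.castSucc t.succ)) (f (X i.castSucc t.castSucc)) :=
    commute_of_cable_left hcable_s (by simp only [List.nodup_cons, List.mem_cons]; grind)
      (h.commute_of_lt ht hr hi hsk)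
  rcases (show j ≤ s by grind).lt_or_eq with hjs | rfl
  · exact of_lt hjs
  obtain ⟨i, hi⟩ : ∃ i : Fin n, i.succ = j.castSucc := ⟨⟨j - 1, by grind⟩, by grind⟩
  have hij : i < j := by grind
  have hcable_i := h.isPureOn_cable_of_lt (t := i) (by grind)
  rw [hi] at hcable_i
  exact (commute_of_cable_left hcable_i (by simp only [List.nodup_cons, List.mem_cons]; grind)
    (of_lt hij).symm).symm

theorem isPure (hn : 4 ≤ n) : IsPure fun a b => f (X a b) :=
  isPure_of_isPureOn_cable hn h.incl fun t =>
    (isPure_degWord_iff (h.isUntwisted hn t) (h.comp_swapInv.isUntwisted hn t)).1 (h.deg t)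

end IsCabled

theorem normalClosure_cablingRels (hn : 4 ≤ n) :
    Subgroup.normalClosure (cablingRels n) = Subgroup.normalClosure (RV (n + 1)) := by
  have isCabled_iff_isPure {Q : Type} [Group Q] (f : FreeGroup (Gen (n + 1)) →* Q) :
      (∀ r ∈ cablingRels n, f r = 1) ↔ ∀ r ∈ RV (n + 1), f r = 1 := by
    rw [isCabled_iff, isPure_iff]
    exact ⟨fun h => h.isPure hn, IsPure.isCabled⟩
  refine le_antisymm (Subgroup.normalClosure_le_normal fun r hr => ?_)
    (Subgroup.normalClosure_le_normal fun r hr => ?_)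
  · exact PresentedGroup.mk_eq_one_iff.1 <| (isCabled_iff_isPure (PresentedGroup.mk _)).2
      (fun _ => PresentedGroup.one_of_mem) r hr
  · exact PresentedGroup.mk_eq_one_iff.1 <| (isCabled_iff_isPure (PresentedGroup.mk _)).1
      (fun _ => PresentedGroup.one_of_mem) r hr

end CablingRelations

section Presentation

variable {n : ℕ} {G : Type*} [Group G]

/-- The families `s i` and `r i` satisfy the defining relations between the generators `σ_i` and
`ρ_i` of the virtual braid group on `n` strands. -/
structure IsVirtualBraid (s r : (i : ℕ) → i + 1 < n → G) : Prop where
  sigma_comm {i j : ℕ} (hi : i + 1 < n) (hj : j + 1 < n) (hij : i + 1 < j) :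
    Commute (s i hi) (s j hj)
  sigma_braid {i : ℕ} (hi : i + 1 < n) (hi' : i + 1 + 1 < n) :
    s i hi * s (i + 1) hi' * s i hi = s (i + 1) hi' * s i hi * s (i + 1) hi'
  rho_sq {i : ℕ} (hi : i + 1 < n) : r i hi * r i hi = 1
  rho_comm {i j : ℕ} (hi : i + 1 < n) (hj : j + 1 < n) (hij : i + 1 < j) :
    Commute (r i hi) (r j hj)
  rho_braid {i : ℕ} (hi : i + 1 < n) (hi' : i + 1 + 1 < n) :
    r i hi * r (i + 1) hi' * r i hi = r (i + 1) hi' * r i hi * r (i + 1) hi'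
  mixed_comm {i j : ℕ} (hi : i + 1 < n) (hj : j + 1 < n) (hij : i + 1 < j ∨ j + 1 < i) :
    Commute (s i hi) (r j hj)
  mixed {i : ℕ} (hi : i + 1 < n) (hi' : i + 1 + 1 < n) :
    r i hi * r (i + 1) hi' * s i hi = s (i + 1) hi' * r i hi * r (i + 1) hi'

theorem isVirtualBraid_iff (f : FreeGroup (VBGen n) →* G) :
    (∀ w, VBRel n w → f w = 1) ↔
      IsVirtualBraid (fun i h => f (fsigma i h)) fun i h => f (frho i h) := by
  refine ⟨fun H => ?_, fun H w hw => ?_⟩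
  · have eq {u v} (h : VBRel n (u * v⁻¹)) : f u = f v := (map_mul_inv_eq_one f).1 (H _ h)
    exact
      { sigma_comm := fun hi hj hij => by
          simpa [commute_iff_eq] using eq (.sigma_comm _ _ hi hj hij)
        sigma_braid := fun hi hi' => by simpa using eq (.sigma_braid _ hi hi')
        rho_sq := fun hi => by simpa using H _ (.rho_sq _ hi)
        rho_comm := fun hi hj hij => by
          simpa [commute_iff_eq] using eq (.rho_comm _ _ hi hj hij)
        rho_braid := fun hi hi' => by simpa using eq (.rho_braid _ hi hi')
        mixed_comm := fun hi hj hij => by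
          simpa [commute_iff_eq] using eq (.mixed_comm _ _ hi hj hij)
        mixed := fun hi hi' => by simpa using eq (.mixed _ hi hi') }
  · have eq {u v} (h : f u = f v) : f (u * v⁻¹) = 1 := (map_mul_inv_eq_one f).2 h
    cases hw with
    | sigma_comm _ _ hi hj hij => exact eq (by simpa using (H.sigma_comm hi hj hij).eq)
    | sigma_braid _ hi hi' => exact eq (by simpa using H.sigma_braid hi hi')
    | rho_sq _ hi => simpa using H.rho_sq hi
    | rho_comm _ _ hi hj hij => exact eq (by simpa using (H.rho_comm hi hj hij).eq)
    | rho_braid _ hi hi' => exact eq (by simpa using H.rho_braid hi hi')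
    | mixed_comm _ _ hi hj hij => exact eq (by simpa using (H.mixed_comm hi hj hij).eq)
    | mixed _ hi hi' => exact eq (by simpa using H.mixed hi hi')

theorem isVirtualBraid_sigma_rho (n : ℕ) :
    IsVirtualBraid (n := n) (fun i h => sigma i h) fun i h => rho i h :=
  (isVirtualBraid_iff (PresentedGroup.mk _)).1 fun _ hw => PresentedGroup.one_of_mem hw

/-- The homomorphism from the virtual braid group given by its universal property. -/
def IsVirtualBraid.lift {s r : (i : ℕ) → i + 1 < n → G} (h : IsVirtualBraid s r) : VB n →* G :=
  PresentedGroup.toGroup (f := fun | .sigma i hi => s i hi | .rho i hi => r i hi) <|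
    (isVirtualBraid_iff _).2 <| by simpa [fsigma, frho] using h

theorem IsVirtualBraid.lift_sigma {s r : (i : ℕ) → i + 1 < n → G} (h : IsVirtualBraid s r)
    (i : ℕ) (hi : i + 1 < n) : h.lift (sigma i hi) = s i hi :=
  PresentedGroup.toGroup.of _

theorem IsVirtualBraid.lift_rho {s r : (i : ℕ) → i + 1 < n → G} (h : IsVirtualBraid s r)
    (i : ℕ) (hi : i + 1 < n) : h.lift (rho i hi) = r i hi :=
  PresentedGroup.toGroup.of _

theorem vb_hom_ext {f g : VB n →* G} (hsigma : ∀ i hi, f (sigma i hi) = g (sigma i hi))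
    (hrho : ∀ i hi, f (rho i hi) = g (rho i hi)) : f = g := by
  refine PresentedGroup.ext fun x => ?_
  cases x with
  | sigma i hi => exact hsigma i hi
  | rho i hi => exact hrho i hi

theorem rho_mul_self (i : ℕ) (hi : i + 1 < n) : rho i hi * rho i hi = 1 :=
  (isVirtualBraid_sigma_rho n).rho_sq hi

theorem perm_rho (i : ℕ) (hi : i + 1 < n) : perm n (rho i hi) = transp i hi :=
  PresentedGroup.toGroup.of _

end Presentation

section SymmetricGroup

theorem transp_apply_of_ne {n i : ℕ} (hi : i + 1 < n) {a : Fin n} (h : (a : ℕ) ≠ i)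
    (h' : (a : ℕ) ≠ i + 1) : transp i hi a = a :=
  Equiv.swap_apply_of_ne_of_ne (by grind) (by grind)

/-- The elements `c i` with `i + 1 < n` satisfy the Coxeter relations between the transpositions of
`i` and `i + 1` in the symmetric group on `n` letters. The other values of `c` are irrelevant. -/
structure IsCoxeter {G : Type*} [Group G] (n : ℕ) (c : ℕ → G) : Prop where
  sq {i : ℕ} (hi : i + 1 < n) : c i * c i = 1
  comm {i j : ℕ} (hij : i + 1 < j) (hj : j + 1 < n) : Commute (c i) (c j)
  braid {i : ℕ} (hi : i + 2 < n) : c i * c (i + 1) * c i = c (i + 1) * c i * c (i + 1)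

variable {n m : ℕ} {G : Type*} [Group G] {c : ℕ → G}

/-- For the simple transpositions `c` of at least `m` letters, this is the subgroup of permutations
of the first `m` letters. -/
def parabolic (c : ℕ → G) (m : ℕ) : Subgroup G := Subgroup.closure (c '' {i | i + 1 < m})

/-- The product `c (k + d - 1) * ⋯ * c k`. -/
def descProd (c : ℕ → G) (k : ℕ) : ℕ → G
  | 0 => 1
  | d + 1 => c (k + d) * descProd c k d

theorem descProd_succ_right (c : ℕ → G) (k d : ℕ) :
    descProd c k (d + 1) = descProd c (k + 1) d * c k := by
  induction d with
  | zero => simp [descProd]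
  | succ d ih => rw [descProd, ih, ← mul_assoc, descProd, Nat.succ_add_eq_add_succ]

theorem mem_parabolic {i : ℕ} (h : i + 1 < m) : c i ∈ parabolic c m :=
  Subgroup.subset_closure ⟨i, h, rfl⟩

theorem commute_of_mem_parabolic {x y : G} (hx : x ∈ parabolic c m)
    (h : ∀ i, i + 1 < m → Commute (c i) y) : Commute x y := by
  have hle : parabolic c m ≤ Subgroup.centralizer {y} := by
    rw [parabolic, Subgroup.closure_le]
    rintro _ ⟨i, hi, rfl⟩
    exact Subgroup.mem_centralizer_singleton_iff.2 (h i hi).eq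
  exact Subgroup.mem_centralizer_singleton_iff.1 (hle hx)

namespace IsCoxeter

variable (hc : IsCoxeter n c)
include hc

theorem inv_eq {i : ℕ} (hi : i + 1 < n) : (c i)⁻¹ = c i :=
  inv_eq_of_mul_eq_one_left (hc.sq hi)

@[elab_as_elim]
theorem parabolic_induction (hm : m ≤ n) {p : (x : G) → x ∈ parabolic c m → Prop}
    (one : p 1 (one_mem _))
    (mul : ∀ x i (hx : x ∈ parabolic c m) (hi : i + 1 < m), p x hx →
      p (x * c i) (mul_mem hx (mem_parabolic hi)))
    {x : G} (hx : x ∈ parabolic c m) : p x hx := by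
  induction hx using Subgroup.closure_induction_right with
  | one => exact one
  | mul_right x hx y hy ih =>
    obtain ⟨i, hi, rfl⟩ := hy
    exact mul x i hx hi ih
  | mul_inv_cancel x hx y hy ih =>
    obtain ⟨i, hi : i + 1 < m, rfl⟩ := hy
    simpa only [hc.inv_eq (hi.trans_le hm)] using mul x i hx hi ih

theorem commute_descProd {j k d : ℕ} (hj : j + 1 < n) (hd : k + d < n)
    (h : j + 1 < k ∨ k + d < j) : Commute (descProd c k d) (c j) := by
  induction d with
  | zero => exact .one_left _
  | succ d ih =>
    refine .mul_left ?_ (ih (by omega) (by omega))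
    rcases h with h | h
    · exact (hc.comm (by omega) (by omega)).symm
    · exact hc.comm (by omega) hj

theorem descProd_mul {j k d : ℕ} (hkj : k ≤ j) (hj : j + 1 < k + d) (hd : k + d < n) :
    descProd c k d * c (j + 1) = c j * descProd c k d := by
  induction d with
  | zero => omega
  | succ d ih =>
    rcases Nat.lt_or_ge (j + 1) (k + d) with hlt | hge
    · rw [descProd, mul_assoc, ih hlt (by omega), ← mul_assoc, ← mul_assoc,
        (hc.comm hlt hd).eq]
    · obtain ⟨e, rfl⟩ : ∃ e, d = e + 1 := ⟨d - 1, by omega⟩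
      obtain rfl : j = k + e := by omega
      rw [descProd, descProd, mul_assoc, mul_assoc,
        (hc.commute_descProd (by omega) (by omega) (by omega)).eq, ← Nat.add_assoc]
      simp only [← mul_assoc]
      rw [hc.braid (by omega)]

/-- The products `descProd c k d` with `k + d = m` represent the right cosets of the subgroup `S_m`
of `S_{m+1}`. -/
theorem exists_mul_descProd (hm : m < n) {x : G} (hx : x ∈ parabolic c (m + 1)) :
    ∃ u ∈ parabolic c m, ∃ k d, k + d = m ∧ x = u * descProd c k d := by
  induction hx using hc.parabolic_induction hm with
  | one => exact ⟨1, one_mem _, m, 0, rfl, by simp [descProd]⟩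
  | mul x j _ hj ih =>
    obtain ⟨u, hu, k, d, rfl, rfl⟩ := ih
    rcases Nat.lt_trichotomy (j + 1) k with h | rfl | h
    · refine ⟨u * c j, mul_mem hu (mem_parabolic (by omega)), k, d, rfl, ?_⟩
      rw [mul_assoc, (hc.commute_descProd (by omega) hm (.inl h)).eq, ← mul_assoc]
    · exact ⟨u, hu, j, d + 1, by omega, by rw [descProd_succ_right, mul_assoc]⟩
    rcases (show k ≤ j by omega).eq_or_lt with rfl | h'
    · obtain ⟨e, rfl⟩ : ∃ e, d = e + 1 := ⟨d - 1, by omega⟩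
      refine ⟨u, hu, k + 1, e, by omega, ?_⟩
      rw [descProd_succ_right, mul_assoc, mul_assoc, hc.sq (by omega), mul_one]
    · obtain ⟨i, rfl⟩ : ∃ i, j = i + 1 := ⟨j - 1, by omega⟩
      refine ⟨u * c i, mul_mem hu (mem_parabolic (by omega)), k, d, rfl, ?_⟩
      rw [mul_assoc, hc.descProd_mul (by omega) (by omega) hm, ← mul_assoc]

variable {π : G →* Equiv.Perm (Fin n)} (hπ : ∀ i (h : i + 1 < n), π (c i) = transp i h)
include hπ

theorem map_apply_of_mem_parabolic (hm : m ≤ n) {x : G} (hx : x ∈ parabolic c m) {a : Fin n}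
    (ha : m ≤ a) : π x a = a := by
  induction hx using hc.parabolic_induction hm with
  | one => simp
  | mul x j _ hj ih =>
    rw [map_mul, hπ j (by omega), Equiv.Perm.mul_apply,
      transp_apply_of_ne _ (by omega) (by omega), ih]

omit hc in
theorem map_descProd_apply (k d : ℕ) (h : k + d < n) :
    π (descProd c k d) ⟨k, by omega⟩ = ⟨k + d, h⟩ := by
  induction d with
  | zero => simp [descProd]
  | succ d ih =>
    rw [descProd, map_mul, Equiv.Perm.mul_apply, ih (by omega), hπ (k + d) h,
      transp, Equiv.swap_apply_left]
    rfl

theorem mem_parabolic_of_map_apply_eq {x : G} (hx : x ∈ parabolic c (m + 1)) (hm : m < n)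
    (h : π x ⟨m, hm⟩ = ⟨m, hm⟩) : x ∈ parabolic c m := by
  obtain ⟨u, hu, k, d, rfl, rfl⟩ := hc.exists_mul_descProd hm hx
  have map_u : π u ⟨k + d, hm⟩ = ⟨k + d, hm⟩ :=
    hc.map_apply_of_mem_parabolic hπ hm.le hu le_rfl
  have map_descProd : π (descProd c k d) ⟨k + d, hm⟩ = ⟨k + d, hm⟩ := by
    rw [map_mul, Equiv.Perm.mul_apply] at h
    exact (π u).injective (h.trans map_u.symm)
  have hd : (⟨k, by omega⟩ : Fin n) = ⟨k + d, hm⟩ :=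
    (π (descProd c k d)).injective ((map_descProd_apply hπ k d hm).trans map_descProd.symm)
  obtain rfl : d = 0 := by simpa [Fin.ext_iff] using hd
  simpa [descProd] using hu

theorem mem_parabolic_of_forall_map_apply_eq (hm : m ≤ n) {x : G} (hx : x ∈ parabolic c n)
    (h : ∀ a : Fin n, m ≤ a → π x a = a) : x ∈ parabolic c m := by
  induction hm using Nat.decreasingInduction with
  | self => exact hx
  | of_succ k hk ih =>
    exact hc.mem_parabolic_of_map_apply_eq hπ (ih fun a ha => h a (by omega)) hk (h _ le_rfl)

theorem eq_one_of_map_eq_one {x : G} (hx : x ∈ parabolic c n) (h : π x = 1) : x = 1 := by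
  have := hc.mem_parabolic_of_forall_map_apply_eq hπ n.zero_le hx fun a _ => by simp [h]
  simpa [parabolic] using this

end IsCoxeter

theorem perm_induction {p : Equiv.Perm (Fin n) → Prop} (π : Equiv.Perm (Fin n)) (one : p 1)
    (mul : ∀ i (h : i + 1 < n) π, p π → p (transp i h * π)) : p π := by
  obtain _ | n := n
  · exact Subsingleton.elim 1 π ▸ one
  have hπ : π ∈ Submonoid.closure (Set.range fun i : Fin n => Equiv.swap i.castSucc i.succ) := by
    rw [Equiv.Perm.mclosure_swap_castSucc_succ]; trivial
  induction hπ using Submonoid.closure_induction_left with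
  | one => exact one
  | mul_left x hx π _ ih =>
    obtain ⟨i, rfl⟩ := hx
    exact mul i (by omega) π ih

end SymmetricGroup

section Equivariant

theorem exists_perm_map_eq {α : Type*} {l l' : List α} (hl : l.Nodup) (hl' : l'.Nodup)
    (h : l.length = l'.length) : ∃ π : Equiv.Perm α, l.map π = l' := by
  obtain ⟨π, hπ⟩ := Equiv.Perm.exists_extending_pair l.get (fun i => l'.get (i.cast h))
    hl.injective_get (hl'.injective_get.comp (Fin.cast_injective h))
  exact ⟨π, List.ext_getElem (by simpa using h) fun i hi _ => by
    simpa using hπ ⟨i, by simpa using hi⟩⟩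

variable {α G Q : Type*} [Group G] [Group Q]

/-- Conjugation by `φ π` permutes the indices of the family `L a b` by `π`. The values `L a a` are
irrelevant. -/
def IsEquivariant (φ : Equiv.Perm α →* Q) (L : α → α → Q) : Prop :=
  ∀ (π : Equiv.Perm α) {a b : α}, a ≠ b → φ π * L a b * (φ π)⁻¹ = L (π a) (π b)

variable {φ : Equiv.Perm α →* Q} {L M : α → α → Q}

/-- Some permutation `π` takes the indices `a`, `b` to `c`, `d`, while conjugation by `φ π` takes
`L a b` to `L c d`. -/
def IsTransport (φ : Equiv.Perm α →* Q) (L : α → α → Q) (a b c d : α) : Prop :=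
  ∃ π : Equiv.Perm α, π a = c ∧ π b = d ∧ SemiconjBy (φ π) (L a b) (L c d)

namespace IsTransport

variable {a b c d e f : α}

theorem refl (φ : Equiv.Perm α →* Q) (L : α → α → Q) (a b : α) : IsTransport φ L a b a b :=
  ⟨1, rfl, rfl, by simp⟩

theorem symm (h : IsTransport φ L a b c d) : IsTransport φ L c d a b := by
  obtain ⟨π, rfl, rfl, hπ⟩ := h
  exact ⟨π⁻¹, by simp, by simp, by simpa using hπ.inv_symm_left⟩

theorem trans (h : IsTransport φ L a b c d) (h' : IsTransport φ L c d e f) :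
    IsTransport φ L a b e f := by
  obtain ⟨π, rfl, rfl, hπ⟩ := h
  obtain ⟨τ, rfl, rfl, hτ⟩ := h'
  exact ⟨τ * π, rfl, rfl, by simpa using hτ.mul_left hπ⟩

end IsTransport

theorem isEquivariant_of_isTransport {a b : α}
    (stab : ∀ π : Equiv.Perm α, π a = a → π b = b → Commute (φ π) (L a b))
    (transport : ∀ c d, c ≠ d → IsTransport φ L a b c d) : IsEquivariant φ L := by
  intro π c d hcd
  obtain ⟨τ, rfl, rfl, hτ⟩ := transport c d hcd
  obtain ⟨τ', hc, hd, hτ'⟩ := transport _ _ (π.injective.ne hcd)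
  have commute : Commute (φ (τ'⁻¹ * (π * τ))) (L a b) :=
    stab _ (by simp [← hc]) (by simp [← hd])
  have := hτ'.mul_left (commute.semiconjBy.mul_left hτ.inv_symm_left)
  refine mul_inv_eq_of_eq_mul ?_
  simpa [mul_assoc] using this.eq

namespace IsEquivariant

theorem map (h : IsEquivariant φ L) (f : Q →* G) :
    IsEquivariant (f.comp φ) fun a b => f (L a b) := fun π a b hab => by
  simp only [MonoidHom.comp_apply, ← h π hab, map_mul, map_inv]

theorem semiconjBy (h : IsEquivariant φ L) (π : Equiv.Perm α) {a b : α} (hab : a ≠ b) :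
    SemiconjBy (φ π) (L a b) (L (π a) (π b)) :=
  mul_inv_eq_iff_eq_mul.1 (h π hab)

theorem commute_of_apply_eq (h : IsEquivariant φ L) {π : Equiv.Perm α} {a b : α} (hab : a ≠ b)
    (ha : π a = a) (hb : π b = b) : Commute (φ π) (L a b) := by
  rw [commute_iff_eq, (h.semiconjBy π hab).eq, ha, hb]

theorem eq_of_eq (hL : IsEquivariant φ L) (hM : IsEquivariant φ M) {a b c d : α} (hab : a ≠ b)
    (hcd : c ≠ d) (h : L a b = M a b) : L c d = M c d := by
  obtain ⟨π, hπ⟩ := exists_perm_map_eq (l := [a, b]) (l' := [c, d]) (by simpa) (by simpa) rfl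
  obtain ⟨rfl, rfl⟩ : π a = c ∧ π b = d := by simpa using hπ
  rw [← hL π hab, ← hM π hab, h]

theorem commute_of_commute (hL : IsEquivariant φ L) {a b c d a' b' c' d' : α}
    (hd : [a, b, c, d].Nodup) (hd' : [a', b', c', d'].Nodup) (h : Commute (L a b) (L c d)) :
    Commute (L a' b') (L c' d') := by
  obtain ⟨π, hπ⟩ := exists_perm_map_eq hd hd' rfl
  obtain ⟨rfl, rfl, rfl, rfl⟩ : π a = a' ∧ π b = b' ∧ π c = c' ∧ π d = d' := by simpa using hπ
  rwa [← hL π (by grind), ← hL π (by grind), Commute.conj_iff]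

theorem triple_of_triple (hL : IsEquivariant φ L) {a b c a' b' c' : α} (hd : [a, b, c].Nodup)
    (hd' : [a', b', c'].Nodup) (h : L a b * L a c * L b c = L b c * L a c * L a b) :
    L a' b' * L a' c' * L b' c' = L b' c' * L a' c' * L a' b' := by
  obtain ⟨π, hπ⟩ := exists_perm_map_eq hd hd' rfl
  obtain ⟨rfl, rfl, rfl⟩ : π a = a' ∧ π b = b' ∧ π c = c' := by simpa using hπ
  rw [← hL π (by grind), ← hL π (by grind), ← hL π (by grind)]
  simp only [conj_mul, h]

end IsEquivariant

section Crossing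

variable [DecidableEq α]

/-- The elements playing the role of `σ_i = λ_{i,i+1}⁻¹ ρ_i`. -/
def crossing (φ : Equiv.Perm α →* Q) (L : α → α → Q) (a b : α) : Q :=
  (L a b)⁻¹ * φ (Equiv.swap a b)

namespace IsEquivariant

theorem isEquivariant_crossing (h : IsEquivariant φ L) : IsEquivariant φ (crossing φ L) := by
  intro π a b hab
  calc φ π * ((L a b)⁻¹ * φ (Equiv.swap a b)) * (φ π)⁻¹
      = (φ π * L a b * (φ π)⁻¹)⁻¹ * (φ π * φ (Equiv.swap a b) * (φ π)⁻¹) := by group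
    _ = crossing φ L (π a) (π b) := by
      rw [h π hab, crossing, Equiv.swap_apply_apply, map_mul, map_mul, map_inv]

theorem commute_crossing_swap (h : IsEquivariant φ L) {a b c d : α} (hd : [a, b, c, d].Nodup) :
    Commute (crossing φ L a b) (φ (Equiv.swap c d)) :=
  (h.isEquivariant_crossing.commute_of_apply_eq (by grind)
    (Equiv.swap_apply_of_ne_of_ne (by grind) (by grind))
    (Equiv.swap_apply_of_ne_of_ne (by grind) (by grind))).symm

theorem swap_mul_swap_mul_crossing (h : IsEquivariant φ L) {a b c : α} (hd : [a, b, c].Nodup) :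
    φ (Equiv.swap a b) * φ (Equiv.swap b c) * crossing φ L a b =
      crossing φ L b c * φ (Equiv.swap a b) * φ (Equiv.swap b c) := by
  have hab : a ≠ b := by grind
  have hac : a ≠ c := by grind
  have hbc : b ≠ c := by grind
  have := (h.isEquivariant_crossing.semiconjBy (.swap a b * .swap b c) hab).eq
  simpa [Equiv.swap_apply_of_ne_of_ne hab hac, Equiv.swap_apply_of_ne_of_ne hac.symm hbc.symm,
    mul_assoc] using this

theorem commute_crossing_iff (h : IsEquivariant φ L) {a b c d : α} (hd : [a, b, c, d].Nodup) :
    Commute (crossing φ L a b) (crossing φ L c d) ↔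
      Commute (L a b) (L c d) := by
  have comm_swap_right : Commute (crossing φ L a b) (φ (Equiv.swap c d)) :=
    h.commute_crossing_swap hd
  have comm_swap_left : Commute (φ (Equiv.swap a b)) (L c d) :=
    h.commute_of_apply_eq (by grind) (Equiv.swap_apply_of_ne_of_ne (by grind) (by grind))
      (Equiv.swap_apply_of_ne_of_ne (by grind) (by grind))
  calc Commute (crossing φ L a b) (crossing φ L c d)
      ↔ Commute (crossing φ L a b) (L c d)⁻¹ := commute_mul_right_iff comm_swap_right
    _ ↔ Commute (L a b)⁻¹ (L c d)⁻¹ := commute_mul_left_iff comm_swap_left.inv_right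
    _ ↔ Commute (L a b) (L c d) := Commute.inv_inv_iff

theorem crossing_braid_iff (h : IsEquivariant φ L) {a b c : α} (hd : [a, b, c].Nodup) :
    crossing φ L a b * crossing φ L b c * crossing φ L a b =
        crossing φ L b c * crossing φ L a b * crossing φ L b c ↔
      L a b * L a c * L b c = L b c * L a c * L a b := by
  have hab : a ≠ b := by grind
  have hac : a ≠ c := by grind
  have hbc : b ≠ c := by grind
  have swap_swap : Equiv.swap a b * Equiv.swap b c * Equiv.swap a b =
      Equiv.swap b c * Equiv.swap a b * Equiv.swap b c := by
    ext x
    simp only [Equiv.Perm.mul_apply, Equiv.swap_apply_def]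
    grind
  have pqp : φ (Equiv.swap a b) * φ (Equiv.swap b c) * φ (Equiv.swap a b) =
      φ (Equiv.swap b c) * φ (Equiv.swap a b) * φ (Equiv.swap b c) := by
    simp only [← map_mul, swap_swap]
  have p_bc : SemiconjBy (φ (Equiv.swap a b)) (L b c) (L a c) := by
    simpa [Equiv.swap_apply_of_ne_of_ne hac.symm hbc.symm] using h.semiconjBy (.swap a b) hbc
  have p_ac : SemiconjBy (φ (Equiv.swap a b)) (L a c) (L b c) := by
    simpa [Equiv.swap_apply_of_ne_of_ne hac.symm hbc.symm] using h.semiconjBy (.swap a b) hac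
  have q_ab : SemiconjBy (φ (Equiv.swap b c)) (L a b) (L a c) := by
    simpa [Equiv.swap_apply_of_ne_of_ne hab hac] using h.semiconjBy (.swap b c) hab
  have q_ac : SemiconjBy (φ (Equiv.swap b c)) (L a c) (L a b) := by
    simpa [Equiv.swap_apply_of_ne_of_ne hab hac] using h.semiconjBy (.swap b c) hac
  rw [crossing, crossing, inv_mul_braid p_bc q_ab p_ac, inv_mul_braid q_ab p_bc q_ac, pqp,
    mul_left_inj, inv_inj, eq_comm]

end IsEquivariant

theorem IsEquivariant.isVirtualBraid_iff {n : ℕ} {φ : Equiv.Perm (Fin n) →* Q}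
    {L : Fin n → Fin n → Q} (h : IsEquivariant φ L) :
    IsVirtualBraid (fun i hi => crossing φ L ⟨i, by omega⟩ ⟨i + 1, hi⟩)
      (fun i hi => φ (transp i hi)) ↔ IsPure L where
  mp H :=
    { comm := fun {i j k l} _ _ _ _ hd => by
        have hn : 4 ≤ n := by simpa using hd.length_le_card
        have hd' : [(⟨0, by omega⟩ : Fin n), ⟨1, by omega⟩, ⟨2, by omega⟩,
          ⟨3, by omega⟩].Nodup := by simp
        exact h.commute_of_commute hd' hd <| (h.commute_crossing_iff hd').1 <|
          H.sigma_comm (i := 0) (j := 2) (by omega) (by omega) (by omega)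
      triple := fun {i j k} _ _ _ hd => by
        have hn : 3 ≤ n := by simpa using hd.length_le_card
        have hd' : [(⟨0, by omega⟩ : Fin n), ⟨1, by omega⟩, ⟨2, by omega⟩].Nodup := by simp
        exact h.triple_of_triple hd' (by grind) <| (h.crossing_braid_iff hd').1 <|
          H.sigma_braid (i := 0) (by omega) (by omega) }
  mpr H :=
    { sigma_comm := fun hi hj hij =>
        have hd := by grind
        (h.commute_crossing_iff hd).2 (H.comm hd)
      sigma_braid := fun hi hi' =>
        (h.crossing_braid_iff (by grind)).2 (H.triple (by grind))
      rho_sq := fun hi => by rw [← map_mul, transp, Equiv.swap_mul_self, map_one]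
      rho_comm := fun hi hj hij => .map (transp_comm _ _ hi hj hij) φ
      rho_braid := fun hi hi' => by simp only [← map_mul, transp_braid]
      mixed_comm := fun hi hj hij => h.commute_crossing_swap (by grind)
      mixed := fun hi hi' => h.swap_mul_swap_mul_crossing (by grind) }

end Crossing

end Equivariant

section SymmetricSubgroup

variable {n m : ℕ}

/-- The generators `ρ_i`, extended by `1` to all natural numbers `i`. -/
def rhoNat (n i : ℕ) : VB n := if h : i + 1 < n then rho i h else 1

theorem rhoNat_of_lt {i : ℕ} (h : i + 1 < n) : rhoNat n i = rho i h := dif_pos h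

theorem isCoxeter_rhoNat (n : ℕ) : IsCoxeter n (rhoNat n) where
  sq hi := by rw [rhoNat_of_lt hi, rho_mul_self]
  comm hij hj := by
    rw [rhoNat_of_lt hj, rhoNat_of_lt (by omega)]
    exact (isVirtualBraid_sigma_rho n).rho_comm _ _ hij
  braid hi := by
    rw [rhoNat_of_lt hi, rhoNat_of_lt (by omega)]
    exact (isVirtualBraid_sigma_rho n).rho_braid _ _

theorem perm_rhoNat (i : ℕ) (hi : i + 1 < n) : perm n (rhoNat n i) = transp i hi := by
  rw [rhoNat_of_lt hi, perm_rho]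

theorem bijective_perm_domRestrict_parabolic (n : ℕ) :
    Function.Bijective ((perm n).comp (parabolic (rhoNat n) n).subtype) := by
  refine ⟨(injective_iff_map_eq_one _).2 fun x hx => ?_, fun π => ?_⟩
  · exact Subtype.ext ((isCoxeter_rhoNat n).eq_one_of_map_eq_one perm_rhoNat x.2 hx)
  · induction π using perm_induction with
    | one => exact ⟨1, map_one _⟩
    | mul i hi π ih =>
      obtain ⟨x, rfl⟩ := ih
      refine ⟨⟨rhoNat n i, mem_parabolic hi⟩ * x, ?_⟩
      rw [map_mul, MonoidHom.comp_apply, Subgroup.subtype_apply, perm_rhoNat]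

/-- The section of `perm n` whose image is the subgroup generated by the `ρ_i`. -/
noncomputable def permSection (n : ℕ) : Equiv.Perm (Fin n) →* VB n :=
  (parabolic (rhoNat n) n).subtype.comp
    (MulEquiv.ofBijective _ (bijective_perm_domRestrict_parabolic n)).symm.toMonoidHom

theorem permSection_mem_parabolic (π : Equiv.Perm (Fin n)) :
    permSection n π ∈ parabolic (rhoNat n) n :=
  Subtype.property _

theorem perm_permSection (π : Equiv.Perm (Fin n)) : perm n (permSection n π) = π :=
  (MulEquiv.ofBijective _ (bijective_perm_domRestrict_parabolic n)).apply_symm_apply π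

theorem permSection_transp (i : ℕ) (hi : i + 1 < n) : permSection n (transp i hi) = rho i hi := by
  have : (MulEquiv.ofBijective _ (bijective_perm_domRestrict_parabolic n)).symm (transp i hi) =
      ⟨rhoNat n i, mem_parabolic hi⟩ := by
    rw [MulEquiv.symm_apply_eq]
    exact (perm_rhoNat i hi).symm
  rw [← rhoNat_of_lt hi]
  exact congrArg Subtype.val this

theorem permSection_mem_parabolic_of_forall_apply_eq {π : Equiv.Perm (Fin n)} (hm : m ≤ n)
    (h : ∀ a : Fin n, m ≤ a → π a = a) : permSection n π ∈ parabolic (rhoNat n) m :=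
  (isCoxeter_rhoNat n).mem_parabolic_of_forall_map_apply_eq perm_rhoNat hm
    (permSection_mem_parabolic π) (by simpa only [perm_permSection])

end SymmetricSubgroup

section LamPair

variable {n : ℕ}

/-- The element `λ_{a,b}` as a virtual braid, as a family in the indices `a ≠ b`. -/
def lamPair (n : ℕ) (a b : Fin n) : VB n := eval n (X a b)

theorem lamPair_of_ne {a b : Fin n} (h : a ≠ b) : lamPair n a b = lamVB ⟨(a, b), h⟩ := by
  simp [lamPair, eval, X, h, lam]

theorem lamPair_up (i d : ℕ) (h : i + d + 1 < n) :
    lamPair n ⟨i, by omega⟩ ⟨i + d + 1, h⟩ = lamUp i d h := by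
  rw [lamPair_of_ne (by grind), lamVB, dif_pos (Fin.lt_def.2 (by grind))]
  congr 1
  grind

theorem lamPair_down (i d : ℕ) (h : i + d + 1 < n) :
    lamPair n ⟨i + d + 1, h⟩ ⟨i, by omega⟩ = lamDown i d h := by
  rw [lamPair_of_ne (by grind), lamVB, dif_neg (Fin.not_lt.2 (Fin.le_def.2 (by grind)))]
  congr 1
  grind

theorem lamPair_self_succ (i : ℕ) (h : i + 1 < n) :
    lamPair n ⟨i, by omega⟩ ⟨i + 1, h⟩ = rho i h * (sigma i h)⁻¹ :=
  lamPair_up i 0 h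

theorem lamPair_succ_self (i : ℕ) (h : i + 1 < n) :
    lamPair n ⟨i + 1, h⟩ ⟨i, by omega⟩ = (sigma i h)⁻¹ * rho i h :=
  lamPair_down i 0 h

theorem isTransport_up_succ (i d : ℕ) (h : i + d + 1 + 1 < n) :
    IsTransport (permSection n) (lamPair n) ⟨i, by omega⟩ ⟨i + d + 1, by omega⟩ ⟨i, by omega⟩
      ⟨i + (d + 1) + 1, h⟩ := by
  refine ⟨transp (i + d + 1) h, transp_apply_of_ne h (by grind) (by grind),
    Equiv.swap_apply_left _ _, ?_⟩
  rw [permSection_transp, lamPair_up, lamPair_up, lamUp, SemiconjBy, mul_assoc _ _ (rho _ _),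
    mul_assoc, rho_mul_self, mul_one]

theorem isTransport_down_succ (i d : ℕ) (h : i + d + 1 + 1 < n) :
    IsTransport (permSection n) (lamPair n) ⟨i + d + 1, by omega⟩ ⟨i, by omega⟩
      ⟨i + (d + 1) + 1, h⟩ ⟨i, by omega⟩ := by
  refine ⟨transp (i + d + 1) h, Equiv.swap_apply_left _ _,
    transp_apply_of_ne h (by grind) (by grind), ?_⟩
  rw [permSection_transp, lamPair_down, lamPair_down, lamDown, SemiconjBy, mul_assoc _ _ (rho _ _),
    mul_assoc, rho_mul_self, mul_one]

theorem isTransport_swap (i : ℕ) (h : i + 1 < n) :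
    IsTransport (permSection n) (lamPair n) ⟨i, by omega⟩ ⟨i + 1, h⟩ ⟨i + 1, h⟩ ⟨i, by omega⟩ := by
  refine ⟨transp i h, Equiv.swap_apply_left _ _, Equiv.swap_apply_right _ _, ?_⟩
  rw [permSection_transp, lamPair_self_succ, lamPair_succ_self, SemiconjBy, ← mul_assoc,
    mul_assoc _ (rho _ _) (rho _ _)]
  simp only [rho_mul_self, one_mul, mul_one]

theorem isTransport_succ (i : ℕ) (h : i + 1 + 1 < n) :
    IsTransport (permSection n) (lamPair n) ⟨i, by omega⟩ ⟨i + 1, by omega⟩ ⟨i + 1, by omega⟩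
      ⟨i + 1 + 1, h⟩ := by
  refine ⟨transp i (by omega) * transp (i + 1) h, ?_, ?_, ?_⟩
  · rw [Equiv.Perm.mul_apply, transp_apply_of_ne h (by simp) (by grind), transp,
      Equiv.swap_apply_left]
  · rw [Equiv.Perm.mul_apply, transp.eq_def (i + 1), Equiv.swap_apply_left,
      transp_apply_of_ne _ (by grind) (by simp)]
  · have H := isVirtualBraid_sigma_rho n
    have semiconj_rho : SemiconjBy (rho i (by omega) * rho (i + 1) h) (rho i (by omega))
        (rho (i + 1) h) := by
      simpa only [SemiconjBy, ← mul_assoc] using H.rho_braid (i := i) (by omega) h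
    have semiconj_sigma : SemiconjBy (rho i (by omega) * rho (i + 1) h) (sigma i (by omega))
        (sigma (i + 1) h) := by
      simpa only [SemiconjBy, ← mul_assoc] using H.mixed (i := i) (by omega) h
    rw [map_mul, permSection_transp, permSection_transp, lamPair_self_succ, lamPair_self_succ]
    exact semiconj_rho.mul_right semiconj_sigma.inv_right

theorem isTransport_zero_one (i : ℕ) (h : i + 1 < n) :
    IsTransport (permSection n) (lamPair n) ⟨0, by omega⟩ ⟨1, by omega⟩ ⟨i, by omega⟩
      ⟨i + 1, h⟩ := by
  induction i with
  | zero => exact .refl _ _ _ _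
  | succ i ih => exact (ih (by omega)).trans (isTransport_succ i h)

theorem isTransport_up (i d : ℕ) (h : i + d + 1 < n) :
    IsTransport (permSection n) (lamPair n) ⟨0, by omega⟩ ⟨1, by omega⟩ ⟨i, by omega⟩
      ⟨i + d + 1, h⟩ := by
  induction d with
  | zero => exact isTransport_zero_one i h
  | succ d ih => exact (ih (by omega)).trans (isTransport_up_succ i d h)

theorem isTransport_down (i d : ℕ) (h : i + d + 1 < n) :
    IsTransport (permSection n) (lamPair n) ⟨0, by omega⟩ ⟨1, by omega⟩ ⟨i + d + 1, h⟩
      ⟨i, by omega⟩ := by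
  induction d with
  | zero => exact (isTransport_zero_one i h).trans (isTransport_swap i h)
  | succ d ih => exact (ih (by omega)).trans (isTransport_down_succ i d h)

theorem isTransport_of_ne (hn : 1 < n) {a b : Fin n} (hab : a ≠ b) :
    IsTransport (permSection n) (lamPair n) ⟨0, by omega⟩ ⟨1, hn⟩ a b := by
  obtain ⟨a, ha⟩ := a
  obtain ⟨b, hb⟩ := b
  rcases lt_or_gt_of_ne (show a ≠ b by simpa using hab) with h | h
  · obtain ⟨d, rfl⟩ := Nat.exists_eq_add_of_lt h
    exact isTransport_up a d hb
  · obtain ⟨d, rfl⟩ := Nat.exists_eq_add_of_lt h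
    exact isTransport_down b d ha

theorem commute_permSection_lamPair_last {m : ℕ} {π : Equiv.Perm (Fin (m + 2))}
    (h : π ⟨m, by omega⟩ = ⟨m, by omega⟩) (h' : π ⟨m + 1, by omega⟩ = ⟨m + 1, by omega⟩) :
    Commute (permSection (m + 2) π) (lamPair (m + 2) ⟨m, by omega⟩ ⟨m + 1, by omega⟩) := by
  have mem : permSection (m + 2) π ∈ parabolic (rhoNat (m + 2)) m :=
    permSection_mem_parabolic_of_forall_apply_eq (by omega) fun a ha => by
      have : a = ⟨m, by omega⟩ ∨ a = ⟨m + 1, by omega⟩ := by grind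
      rcases this with ha | ha <;> simpa only [ha]
  have H := isVirtualBraid_sigma_rho (m + 2)
  refine commute_of_mem_parabolic mem fun i hi => ?_
  rw [lamPair_self_succ, rhoNat_of_lt (by omega)]
  exact (H.rho_comm _ _ hi).mul_right (H.mixed_comm _ _ (.inr hi)).symm.inv_right

theorem isEquivariant_lamPair (n : ℕ) : IsEquivariant (permSection n) (lamPair n) := by
  rcases Nat.lt_or_ge n 2 with hn | hn
  · have : Subsingleton (Fin n) := Fin.subsingleton_iff_le_one.2 (by omega)
    exact fun π a b hab => (hab (Subsingleton.elim a b)).elim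
  · obtain ⟨m, rfl⟩ := Nat.exists_eq_add_of_le' hn
    have transport {a b : Fin (m + 2)} (hab : a ≠ b) := isTransport_of_ne (by omega) hab
    exact isEquivariant_of_isTransport (fun π => commute_permSection_lamPair_last) fun a b hab =>
      (transport (a := ⟨m, by omega⟩) (b := ⟨m + 1, by omega⟩) (by simp)).symm.trans (transport hab)

theorem crossing_permSection (i : ℕ) (hi : i + 1 < n) :
    crossing (permSection n) (lamPair n) ⟨i, by omega⟩ ⟨i + 1, hi⟩ = sigma i hi := by
  rw [crossing, lamPair_self_succ, ← transp, permSection_transp, mul_inv_rev, inv_inv,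
    inv_mul_cancel_right]

theorem isPure_lamPair (n : ℕ) : IsPure (lamPair n) :=
  (isEquivariant_lamPair n).isVirtualBraid_iff.1 <| by
    simpa only [crossing_permSection, permSection_transp] using isVirtualBraid_sigma_rho n

theorem isPure_eval (n : ℕ) : IsPure fun a b => eval n (X a b) where
  comm _ _ _ _ hd := Subtype.ext ((isPure_lamPair n).comm hd)
  triple _ _ _ hd := Subtype.ext ((isPure_lamPair n).triple hd)

end LamPair

section PureGroup

variable {n : ℕ} {Q : Type*} [Group Q]

/-- The group presented by the standard relations of the virtual pure braid group. -/
abbrev PureGroup (n : ℕ) : Type := PresentedGroup (RV n)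

/-- The generator `λ_{a,b}` of `PureGroup n`, as a family in the indices `a ≠ b`. -/
def gen {n : ℕ} (a b : Fin n) : PureGroup n := PresentedGroup.mk (RV n) (X a b)

theorem isPure_gen (n : ℕ) : IsPure (gen (n := n)) :=
  (isPure_iff (PresentedGroup.mk (RV n))).1 fun _ hr => PresentedGroup.one_of_mem hr

theorem pureGroup_hom_ext {f g : PureGroup n →* Q}
    (h : ∀ a b, a ≠ b → f (gen a b) = g (gen a b)) : f = g :=
  PresentedGroup.ext fun x => by simpa [gen, X, x.2, PresentedGroup.of] using h x.1.1 x.1.2 x.2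

/-- The homomorphism from `PureGroup n` given by its universal property. -/
def IsPure.lift {L : Fin n → Fin n → Q} (h : IsPure L) : PureGroup n →* Q :=
  PresentedGroup.toGroup (f := fun g : Gen n => L g.1.1 g.1.2) <|
    (isPure_iff _).2 h.isPure_lift_X

theorem IsPure.lift_gen {L : Fin n → Fin n → Q} (h : IsPure L) {a b : Fin n} (hab : a ≠ b) :
    h.lift (gen a b) = L a b :=
  lift_X L hab

/-- Renumbering the strands by a permutation. -/
def permHom (π : Equiv.Perm (Fin n)) : PureGroup n →* PureGroup n :=
  ((isPureOn_range_iff π.injective).1 ((isPure_gen n).mono (Set.subset_univ _))).lift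

theorem permHom_gen (π : Equiv.Perm (Fin n)) {a b : Fin n} (hab : a ≠ b) :
    permHom π (gen a b) = gen (π a) (π b) :=
  IsPure.lift_gen _ hab

theorem permHom_one : permHom (1 : Equiv.Perm (Fin n)) = MonoidHom.id _ :=
  pureGroup_hom_ext fun _ _ hab => permHom_gen _ hab

theorem permHom_mul (π τ : Equiv.Perm (Fin n)) :
    permHom (π * τ) = (permHom π).comp (permHom τ) :=
  pureGroup_hom_ext fun a b hab => by
    simp [permHom_gen _ hab, permHom_gen _ (τ.injective.ne hab)]

/-- The action of the symmetric group on `PureGroup n` by renumbering the strands. -/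
def permAut (n : ℕ) : Equiv.Perm (Fin n) →* MulAut (PureGroup n) where
  toFun π := (permHom π).toMulEquiv (permHom π⁻¹)
    (by rw [← permHom_mul, inv_mul_cancel, permHom_one])
    (by rw [← permHom_mul, mul_inv_cancel, permHom_one])
  map_one' := by ext x; simp [permHom_one]
  map_mul' π τ := by ext x; simp [permHom_mul]

/-- The semidirect product of `PureGroup n` and the symmetric group, which is another model of the
virtual braid group. -/
abbrev PureSemi (n : ℕ) : Type := PureGroup n ⋊[permAut n] Equiv.Perm (Fin n)

open SemidirectProduct

theorem isEquivariant_inl_gen (n : ℕ) :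
    IsEquivariant (inr : _ →* PureSemi n) fun a b => inl (gen a b) := fun π a b hab => by
  rw [← map_inv, ← inl_aut]
  exact congrArg inl (permHom_gen π hab)

/-- The homomorphism `ρ_i ↦ (i i+1)`, `σ_i ↦ λ_{i,i+1}⁻¹ (i i+1)`. -/
def toSemi (n : ℕ) : VB n →* PureSemi n :=
  ((isEquivariant_inl_gen n).isVirtualBraid_iff.2
    ((isPure_iff (inl.comp (PresentedGroup.mk _))).1 fun r hr => by
      rw [MonoidHom.comp_apply, PresentedGroup.one_of_mem hr, map_one])).lift

theorem toSemi_sigma (i : ℕ) (hi : i + 1 < n) : toSemi n (sigma i hi) =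
    crossing inr (fun a b => inl (gen a b)) ⟨i, by omega⟩ ⟨i + 1, hi⟩ :=
  IsVirtualBraid.lift_sigma _ i hi

theorem toSemi_rho (i : ℕ) (hi : i + 1 < n) : toSemi n (rho i hi) = inr (transp i hi) :=
  IsVirtualBraid.lift_rho _ i hi

theorem toSemi_permSection (π : Equiv.Perm (Fin n)) : toSemi n (permSection n π) = inr π := by
  induction π using perm_induction with
  | one => simp
  | mul i hi π ih => rw [map_mul, map_mul, permSection_transp, toSemi_rho, ih, map_mul]

theorem toSemi_lamPair {a b : Fin n} (hab : a ≠ b) :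
    toSemi n (lamPair n a b) = inl (gen a b) := by
  have hn : 1 < n := by grind
  have comp_permSection : (toSemi n).comp (permSection n) = inr :=
    MonoidHom.ext toSemi_permSection
  refine (comp_permSection ▸ (isEquivariant_lamPair n).map (toSemi n)).eq_of_eq
    (isEquivariant_inl_gen n) (a := ⟨0, by omega⟩) (b := ⟨1, hn⟩) (by simp) hab ?_
  rw [lamPair_self_succ 0 hn, map_mul, map_inv, toSemi_sigma, toSemi_rho, crossing, mul_inv_rev,
    inv_inv, transp, mul_inv_cancel_left]

theorem toSemi_eval (w : FreeGroup (Gen n)) :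
    toSemi n (eval n w) = inl (PresentedGroup.mk (RV n) w) := by
  have : ((toSemi n).comp (VP n).subtype).comp (eval n) =
      (inl : PureGroup n →* PureSemi n).comp (PresentedGroup.mk (RV n)) :=
    freeGroup_hom_ext fun _ _ hab => toSemi_lamPair hab
  exact DFunLike.congr_fun this w

theorem ker_eval (n : ℕ) : (eval n).ker = Subgroup.normalClosure (RV n) := by
  refine le_antisymm (fun w hw => ?_) (Subgroup.normalClosure_le_normal ?_)
  · rw [← PresentedGroup.mk_eq_one_iff, ← inl_injective.eq_iff (f := inl (φ := permAut n)),
      ← toSemi_eval, MonoidHom.mem_ker.1 hw, OneMemClass.coe_one, map_one, map_one]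
  · exact (isPure_iff (eval n)).2 (isPure_eval n)

/-- The homomorphism from the semidirect product inverse to `toSemi n`. -/
noncomputable def ofSemi (n : ℕ) : PureSemi n →* VB n :=
  lift (isPure_lamPair n).lift (permSection n) fun π =>
    pureGroup_hom_ext fun a b hab => by
      have hπ : permAut n π (gen a b) = gen (π a) (π b) := permHom_gen π hab
      simp [hπ, IsPure.lift_gen _ hab, IsPure.lift_gen _ (π.injective.ne hab),
        ← isEquivariant_lamPair n π hab]

theorem ofSemi_toSemi (β : VB n) : ofSemi n (toSemi n β) = β := by
  have ofSemi_inl_gen {a b : Fin n} (hab : a ≠ b) :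
      ofSemi n (inl (gen a b)) = lamPair n a b := by
    rw [ofSemi, lift_inl, IsPure.lift_gen _ hab]
  have ofSemi_inr (π) : ofSemi n (inr π) = permSection n π := lift_inr _ _ _ _
  have : (ofSemi n).comp (toSemi n) = MonoidHom.id _ := by
    refine vb_hom_ext (fun i hi => ?_) fun i hi => ?_
    · rw [MonoidHom.comp_apply, toSemi_sigma, crossing, map_mul, map_inv,
        ofSemi_inl_gen (by simp), ofSemi_inr, MonoidHom.id_apply, ← crossing, crossing_permSection]
    · rw [MonoidHom.comp_apply, toSemi_rho, ofSemi_inr, permSection_transp, MonoidHom.id_apply]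
  exact DFunLike.congr_fun this β

theorem exists_eq_eval_mul_permSection (β : VB n) :
    ∃ w π, β = eval n w * permSection n π := by
  obtain ⟨w, hw⟩ := PresentedGroup.mk_surjective _ (toSemi n β).left
  refine ⟨w, (toSemi n β).right, Function.LeftInverse.injective ofSemi_toSemi ?_⟩
  rw [map_mul, toSemi_eval, toSemi_permSection, hw, inl_left_mul_inr_right]

theorem eval_surjective (n : ℕ) : Function.Surjective (eval n) := by
  rintro ⟨β, hβ⟩
  obtain ⟨w, π, rfl⟩ := exists_eq_eval_mul_permSection β
  obtain rfl : π = 1 := by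
    rwa [MonoidHom.mem_ker, map_mul, MonoidHom.mem_ker.1 (eval n w).2, perm_permSection,
      one_mul] at hβ
  exact ⟨w, Subtype.ext (by simp only [map_one, mul_one])⟩

end PureGroup

section AddStrand

variable {n : ℕ} {Q : Type*} [Group Q]

theorem existsUnique_hom_eval (f : FreeGroup (Gen n) →* Q) (hf : IsPure fun a b => f (X a b)) :
    ∃! s : VP n →* Q, ∀ w, s (eval n w) = f w := by
  have ker_le : (eval n).ker ≤ f.ker :=
    (ker_eval n).trans_le (Subgroup.normalClosure_le_normal ((isPure_iff f).2 hf))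
  have lift_eval (w) : (eval n).liftOfSurjective (eval_surjective n) ⟨f, ker_le⟩ (eval n w) = f w :=
    MonoidHom.liftOfRightInverse_comp_apply _ _ _ _ w
  exact ⟨_, lift_eval, fun s hs => (MonoidHom.cancel_right (eval_surjective n)).1 <|
    MonoidHom.ext fun w => (hs w).trans (lift_eval w).symm⟩

theorem existsUnique_degeneracy (t : Fin n) : ∃! s : VP n →* VP (n + 1),
    ∀ w, s (eval n w) = eval (n + 1) (degWord t w) :=
  existsUnique_hom_eval ((eval (n + 1)).comp (degWord t)) ((isPure_eval (n + 1)).isCabled.deg t)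

theorem addStrand_sigma (i : ℕ) (h : i + 1 < n) :
    addStrand n (sigma i h) = sigma i (by omega) :=
  PresentedGroup.toGroup.of _

theorem addStrand_rho (i : ℕ) (h : i + 1 < n) : addStrand n (rho i h) = rho i (by omega) :=
  PresentedGroup.toGroup.of _

theorem addStrand_lamUp (i d : ℕ) (h : i + d + 1 < n) :
    addStrand n (lamUp i d h) = lamUp i d (by omega) := by
  induction d with
  | zero => rw [lamUp, map_mul, map_inv, addStrand_sigma, addStrand_rho, lamUp]
  | succ d ih => rw [lamUp, map_mul, map_mul, ih, addStrand_rho, lamUp]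

theorem addStrand_lamDown (i d : ℕ) (h : i + d + 1 < n) :
    addStrand n (lamDown i d h) = lamDown i d (by omega) := by
  induction d with
  | zero => rw [lamDown, map_mul, map_inv, addStrand_sigma, addStrand_rho, lamDown]
  | succ d ih => rw [lamDown, map_mul, map_mul, ih, addStrand_rho, lamDown]

theorem addStrand_lamPair {a b : Fin n} (hab : a ≠ b) :
    addStrand n (lamPair n a b) = lamPair (n + 1) a.castSucc b.castSucc := by
  rw [lamPair_of_ne hab, lamPair_of_ne (by simpa), lamVB, lamVB]
  simp only [Fin.castSucc_lt_castSucc_iff, Fin.val_castSucc, apply_dite (addStrand n),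
    addStrand_lamUp, addStrand_lamDown]

theorem addStrand_eval (w : FreeGroup (Gen n)) :
    addStrand n (eval n w) = eval (n + 1) (inclWord n w) := by
  have : ((addStrand n).comp (VP n).subtype).comp (eval n) =
      ((VP (n + 1)).subtype.comp (eval (n + 1))).comp (inclWord n) :=
    freeGroup_hom_ext fun a b hab => by
      rw [MonoidHom.comp_apply _ (inclWord n), inclWord_X hab]
      exact addStrand_lamPair hab
  exact DFunLike.congr_fun this w

/-- The homomorphism of virtual pure braid groups adding a trivial last strand. -/
def addStrandPure (n : ℕ) : VP n →* VP (n + 1) :=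
  ((addStrand n).comp (VP n).subtype).codRestrict (VP (n + 1)) fun β => by
    obtain ⟨w, rfl⟩ := eval_surjective n β
    rw [MonoidHom.comp_apply, Subgroup.subtype_apply, addStrand_eval]
    exact (eval (n + 1) _).2

theorem addStrandPure_eval (w : FreeGroup (Gen n)) :
    addStrandPure n (eval n w) = eval (n + 1) (inclWord n w) :=
  Subtype.ext (addStrand_eval w)

/-- Forgetting the last strand: the family `L`, extended by `1` to the pairs of strands involving
the last one. -/
def extendByOne (L : Fin n → Fin n → Q) (a b : Fin (n + 1)) : Q :=
  Fin.lastCases 1 (fun a => Fin.lastCases 1 (fun b => L a b) b) a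

theorem extendByOne_last_left (L : Fin n → Fin n → Q) (b : Fin (n + 1)) :
    extendByOne L (Fin.last n) b = 1 := by
  simp [extendByOne]

theorem extendByOne_last_right (L : Fin n → Fin n → Q) (a : Fin (n + 1)) :
    extendByOne L a (Fin.last n) = 1 := by
  cases a using Fin.lastCases <;> simp [extendByOne]

theorem extendByOne_castSucc (L : Fin n → Fin n → Q) (a b : Fin n) :
    extendByOne L a.castSucc b.castSucc = L a b := by
  simp [extendByOne]

theorem IsPure.extendByOne {L : Fin n → Fin n → Q} (h : IsPure L) :
    IsPure (VirtualBraid.extendByOne L) where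
  comm {i j k l} _ _ _ _ hd := by
    cases i using Fin.lastCases <;> cases j using Fin.lastCases <;>
      cases k using Fin.lastCases <;> cases l using Fin.lastCases <;>
      simp only [extendByOne_last_left, extendByOne_last_right, extendByOne_castSucc,
        Commute.one_left, Commute.one_right]
    exact h.comm (by grind)
  triple {i j k} _ _ _ hd := by
    cases i using Fin.lastCases <;> cases j using Fin.lastCases <;>
      cases k using Fin.lastCases <;>
      simp only [extendByOne_last_left, extendByOne_last_right, extendByOne_castSucc,
        mul_one, one_mul]
    exact h.triple (by grind)

theorem addStrandPure_injective (n : ℕ) : Function.Injective (addStrandPure n) := by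
  obtain ⟨forget, hforget, -⟩ := existsUnique_hom_eval _ (isPure_eval n).extendByOne.isPure_lift_X
  have : (forget.comp (addStrandPure n)).comp (eval n) = (MonoidHom.id _).comp (eval n) :=
    freeGroup_hom_ext fun a b hab => by
      simp only [MonoidHom.comp_apply, addStrandPure_eval, hforget, inclWord_X hab,
        lift_X _ ((Fin.castSucc_injective n).ne hab), extendByOne_castSucc, MonoidHom.id_apply]
  exact Function.LeftInverse.injective
    (DFunLike.congr_fun ((MonoidHom.cancel_right (eval_surjective n)).1 this))

/-- The isomorphism onto `VP (n + 1)` from the group with generators `λ_{i,j}` and relators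
`cablingRels n`. -/
noncomputable def cablingEquiv (hn : 4 ≤ n) : PresentedGroup (cablingRels n) ≃* VP (n + 1) :=
  (QuotientGroup.quotientMulEquivOfEq
    ((normalClosure_cablingRels hn).trans (ker_eval (n + 1)).symm)).trans
    (QuotientGroup.quotientKerEquivOfSurjective _ (eval_surjective (n + 1)))

theorem cablingEquiv_of (hn : 4 ≤ n) (g : Gen (n + 1)) :
    cablingEquiv hn (PresentedGroup.of g) = lam g :=
  FreeGroup.lift_apply_of

end AddStrand

end VirtualBraid

open VirtualBraid in
theorem mainTheorem3 (n : ℕ) (hn : 4 ≤ n) :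
    (∃ ι : VP n →* VP (n + 1), Function.Injective ι ∧
      (∀ β : VP n, (ι β : VB (n + 1)) = addStrand n β) ∧
      ∀ w : FreeGroup (Gen n), ι (eval n w) = eval (n + 1) (inclWord n w)) ∧
    (∀ t : Fin n, ∃! s : VP n →* VP (n + 1),
      ∀ w : FreeGroup (Gen n), s (eval n w) = eval (n + 1) (degWord t w)) ∧
    ∃ e : PresentedGroup (cablingRels n) ≃* VP (n + 1),
      ∀ g : Gen (n + 1), e (PresentedGroup.of g) = lam g := by
  exact ⟨⟨addStrandPure n, addStrandPure_injective n, fun _ => rfl, addStrandPure_eval⟩,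
    existsUnique_degeneracy, cablingEquiv hn, cablingEquiv_of hn⟩
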